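/- Throughout, $\mathfrak S_n$ is the symmetric group and $\pi_u$ denotes the permuton of $u\in\mathfrak S_n$, i.e. the probability measure on $[0,1]^2$ with constant density $n$ on each square $[\frac{i-1}n,\frac in]\times[\frac{u(i)-1}n,\frac{u(i)}n]$, $1\le i\le n$, and density $0$ elsewhere. A permuton is a probability measure $\mu$ on $[0,1]^2$ with $\mu([0,1]\times[a,b])=\mu([a,b]\times[0,1])=b-a$ for $0\le a\le b\le 1$; its height function is $\mathbf H_\mu(x,y)=\mu([x,1]\times[0,y])$, and $\mathbf H_u:=\mathbf H_{\pi_u}$. For $1\le i\le n-1$, let $s_i=(i\;\,i+1)$, let $\ell(u)$ be the number of inversions of $u$, and put $\tau_i(u)=us_i$ if $\ell(us_i)>\ell(u)$ and $\tau_i(u)=u$ otherwise; for a word $\mathbf w=(i_1,\dots,i_r)$ put $\tau_{\mathbf w}=\tau_{i_r}\circ\cdots\circ\tau_{i_1}$. Let $\boldsymbol\Lambda_n$ be the set of lattice paths with unit east and unit south steps that start on the line $x-y=0$ and end on the line $x-y=n$. For $\Lambda\in\boldsymbol\Lambda_n$ let $\theta_\Lambda:[0,1]\to\mathbb R$ be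 the function such that the scaled path $\frac1n\Lambda$ is the curve $z\mapsto(\theta_\Lambda(z),\theta_\Lambda(z)-z)$. If $\Lambda_\swarrow,\Lambda_\nearrow\in\boldsymbol\Lambda_n$ and $\Lambda_\swarrow$ stays weakly southwest of $\Lambda_\nearrow$, let $\mathscr S(\Lambda_\swarrow,\Lambda_\nearrow)$ be the set of unit boxes with integer lower-left vertex $(x,y)$ that lie in the region bounded by the two paths and the lines $x-y=0$ and $x-y=n$. Order boxes by comparing both coordinates of their lower-left vertices; listing the contents $x-y$ of the boxes of a shape $\mathscr S$ along a linear extension of this order gives a word $\mathbf w(\mathscr S)$. Let $\mathfrak B$ be the set of continuous, piecewise smooth functions $\theta:[0,1]\to\mathbb R$ (continuously differentiable on $(0,1)$ away from a finite set) whose derivative lies in $[0,1]$ wherever it exists. For $\varphi,\psi\in\mathfrak B$ put $$\mathsf h_1^{\varphi,\psi}(x,y)=\min\{\max\{0,\;y-x,\;\psi(x)-\varphi(y)+y-x\},\;1-x,\;y\}.$$ **Theorem.** Let $\varphi,\psi\in\mathfrak B$ satisfy $\varphi(z)\le\psi(z)$ for all $z\in[0,1]$. For each $n\ge1$ let $\Lambda^{(n)}_\swarrow,\Lambda^{(n)}_\nearrow\in\boldsymbol\Lambda_n$,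 with the former weakly southwest of the latter, and assume that $\theta_{\Lambda^{(n)}_\swarrow}\to\varphi$ and $\theta_{\Lambda^{(n)}_\nearrow}\to\psi$ pointwise on $[0,1]$. Let $\mathscr S^{(n)}=\mathscr S(\Lambda^{(n)}_\swarrow,\Lambda^{(n)}_\nearrow)$, and for each $n$ choose any word $\mathbf w(\mathscr S^{(n)})$ as above. (1) Let $v_n\in\mathfrak S_n$ be such that $\pi_{v_n}$ converges weakly to a permuton $\mu$, and let $u_n=\tau_{\mathbf w(\mathscr S^{(n)})}(v_n)$. Then for each $(x,y)\in[0,1]^2$, $$\lim_{n\to\infty}\mathbf H_{u_n}(x,y)=\min_{0\le\gamma\le1}\bigl(\mathbf H_\mu(\gamma,y)+\mathsf h_1^{\varphi,\psi}(x,\gamma)\bigr).$$ (2) Let $(v_n)_{n\ge1}$ be independent random permutations, with $v_n$ uniformly distributed on $\mathfrak S_n$, and let $u_n=\tau_{\mathbf w(\mathscr S^{(n)})}(v_n)$. Then for each $(x,y)\in[0,1]^2$, with probability $1$, $$\lim_{n\to\infty}\mathbf H_{u_n}(x,y)=\min_{0\le\gamma\le1}\bigl((1-\gamma)y+\mathsf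 h_1^{\varphi,\psi}(x,\gamma)\bigr).$$ In both parts the minimum over $\gamma$ is attained. -/

import Mathlib

open MeasureTheory ProbabilityTheory Filter Topology unitInterval

/-! ### Permutons, plots of permutations, height functions -/

/-- A probability measure on the unit square is a permuton if both marginals are uniform. -/
def IsPermuton (μ : ProbabilityMeasure (I × I)) : Prop :=
  ∀ a b : I, a ≤ b →
    (μ : Measure (I × I)) (Set.univ ×ˢ Set.Icc a b) = ENNReal.ofReal ((b : ℝ) - a) ∧
    (μ : Measure (I × I)) (Set.Icc a b ×ˢ Set.univ) = ENNReal.ofReal ((b : ℝ) - a)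

/-- The square of side `1/n` that replaces the point `(i/n, u(i)/n)` of the plot of `u`.
The position `i` and the value `u(i)` of the paper are `i + 1` and `u i + 1` here. -/
def plotSquare {n : ℕ} (u : Equiv.Perm (Fin n)) (i : Fin n) : Set (I × I) :=
  {p | ((i : ℕ) : ℝ) ≤ n * (p.1 : ℝ) ∧ n * (p.1 : ℝ) ≤ ((i : ℕ) : ℝ) + 1 ∧
       ((u i : ℕ) : ℝ) ≤ n * (p.2 : ℝ) ∧ n * (p.2 : ℝ) ≤ ((u i : ℕ) : ℝ) + 1}

/-- The measure with constant density `n` on each of the squares `plotSquare u i`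
and density `0` elsewhere. -/
noncomputable def plotMeasure {n : ℕ} (u : Equiv.Perm (Fin n)) : Measure (I × I) :=
  ∑ i : Fin n, (n : ENNReal) • (volume : Measure (I × I)).restrict (plotSquare u i)

theorem volume_plotSquare {n : ℕ} (u : Equiv.Perm (Fin n)) (i : Fin n) :
    (volume : Measure (I × I)) (plotSquare u i) = (n : ENNReal)⁻¹ * (n : ENNReal)⁻¹ := by
  have hn : 0 < n := i.pos
  have hn' : (0 : ℝ) < n := by exact_mod_cast hn
  have key : ∀ j : Fin n, ∃ a b : I, (a : ℝ) = (j : ℕ) / n ∧ (b : ℝ) = ((j : ℕ) + 1) / n := by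
    intro j
    have hj : ((j : ℕ) : ℝ) + 1 ≤ n := by exact_mod_cast j.isLt
    refine ⟨⟨(j : ℕ) / n, by positivity, ?_⟩, ⟨((j : ℕ) + 1) / n, by positivity, ?_⟩, rfl, rfl⟩
    · rw [div_le_one hn']; linarith
    · rw [div_le_one hn']; exact hj
  obtain ⟨a, b, ha, hb⟩ := key i
  obtain ⟨c, d, hc, hd⟩ := key (u i)
  have hs : plotSquare u i = Set.Icc a b ×ˢ Set.Icc c d := by
    ext p
    simp only [plotSquare, Set.mem_ofPred_eq, Set.mem_prod, Set.mem_Icc, ← Subtype.coe_le_coe,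
      ha, hb, hc, hd, div_le_iff₀ hn', le_div_iff₀ hn', mul_comm (p.1 : ℝ), mul_comm (p.2 : ℝ)]
    tauto
  have hl : ∀ t : ℝ, (t + 1) / n - t / n = (n : ℝ)⁻¹ := by intro t; field_simp; ring
  have hinv : ENNReal.ofReal ((n : ℝ)⁻¹) = (n : ENNReal)⁻¹ := by
    rw [ENNReal.ofReal_inv_of_pos hn', ENNReal.ofReal_natCast]
  rw [hs, Measure.volume_eq_prod, Measure.prod_prod, unitInterval.volume_Icc,
    unitInterval.volume_Icc, ha, hb, hc, hd, hl, hl, hinv]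

theorem isProbabilityMeasure_plotMeasure {n : ℕ} [NeZero n] (u : Equiv.Perm (Fin n)) :
    IsProbabilityMeasure (plotMeasure u) := by
  have h0 : (n : ENNReal) ≠ 0 := by exact_mod_cast NeZero.ne n
  have ht : (n : ENNReal) ≠ ⊤ := ENNReal.natCast_ne_top n
  constructor
  simp only [plotMeasure, Measure.coe_finsetSum, Finset.sum_apply, Measure.smul_apply,
    Measure.restrict_apply_univ, volume_plotSquare, smul_eq_mul, Finset.sum_const,
    Finset.card_univ, Fintype.card_fin, nsmul_eq_mul]
  rw [← mul_assoc (n : ENNReal) (n : ENNReal)⁻¹, ENNReal.mul_inv_cancel h0 ht, one_mul,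
    ENNReal.mul_inv_cancel h0 ht]

/-- The permuton `π_u` of a permutation `u`, as a point of the space of probability measures on
the unit square, whose topology is that of weak convergence. -/
noncomputable def plotPermuton {n : ℕ} [NeZero n] (u : Equiv.Perm (Fin n)) :
    ProbabilityMeasure (I × I) :=
  ⟨plotMeasure u, isProbabilityMeasure_plotMeasure u⟩

/-- The height function `H_μ(x, y) = μ([x,1] × [0,y])`. -/
noncomputable def heightFunction (μ : ProbabilityMeasure (I × I)) (x y : I) : ℝ :=
  (μ : Measure (I × I)).real (Set.Icc x 1 ×ˢ Set.Icc 0 y)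

/-! ### The operators `τ_i` -/

/-- The number of inversions of `v`: pairs `a < b` of values with `v⁻¹ a > v⁻¹ b`. -/
def invCount {n : ℕ} (v : Equiv.Perm (Fin n)) : ℕ :=
  (Finset.univ.filter fun p : Fin n × Fin n => p.1 < p.2 ∧ v⁻¹ p.2 < v⁻¹ p.1).card

/-- For `1 ≤ i ≤ n - 1`, the transposition of `i` and `i + 1` (that is, of the elements
`i - 1` and `i` of `Fin n`). Other values of `i` never occur as letters and give `1`. -/
def simpleTransposition (n i : ℕ) : Equiv.Perm (Fin n) :=
  if h : 1 ≤ i ∧ i < n then Equiv.swap ⟨i - 1, by omega⟩ ⟨i, h.2⟩ else 1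

/-- The operator `τ_i`: multiply on the right by `s_i` if this increases the number of
inversions. -/
def tau {n : ℕ} (i : ℕ) (u : Equiv.Perm (Fin n)) : Equiv.Perm (Fin n) :=
  if invCount u < invCount (u * simpleTransposition n i) then u * simpleTransposition n i else u

/-- For a word `(i_1, …, i_r)`, the operator `τ_{i_r} ∘ ⋯ ∘ τ_{i_1}`
(the first letter acts first). -/
def tauWord {n : ℕ} (w : List ℕ) (v : Equiv.Perm (Fin n)) : Equiv.Perm (Fin n) :=
  w.foldl (fun u i => tau i u) v

/-! ### Lattice paths and order-convex shapes -/

/-- A lattice path with unit east and south steps from the line `x - y = 0` to the line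
`x - y = n`, given by its vertices. Each step increases `x - y` by one, so the `i`-th vertex lies
on `x - y = i` and the path has exactly `n` steps. -/
structure LatticePath (n : ℕ) where
  pt : Fin (n + 1) → ℤ × ℤ
  start : (pt 0).1 = (pt 0).2
  step : ∀ i : Fin n, pt i.succ = pt i.castSucc + (1, 0) ∨ pt i.succ = pt i.castSucc + (0, -1)

/-- `P` stays weakly southwest of `Q`. The two `i`-th vertices lie on the same line `x - y = i`,
so they may be compared through their `x`-coordinates. -/
def LatticePath.WeaklySW {n : ℕ} (P Q : LatticePath n) : Prop :=
  ∀ i, (P.pt i).1 ≤ (Q.pt i).1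

/-- The lattice point `p` lies in the closed region bounded by `P`, `Q` and the lines `x - y = 0`
and `x - y = n`. -/
def InRegion {n : ℕ} (P Q : LatticePath n) (p : ℤ × ℤ) : Prop :=
  ∃ i : Fin (n + 1), p.1 - p.2 = ((i : ℕ) : ℤ) ∧ (P.pt i).1 ≤ p.1 ∧ p.1 ≤ (Q.pt i).1

/-- The order-convex shape bounded by `P` and `Q`. The unit box with lower-left vertex `b` is
represented by `b`; it lies in the region bounded by `P` and `Q` iff its four vertices do, since
each of its two halves (cut along its diagonal of slope `1`) lies in a strip
`k ≤ x - y ≤ k + 1`, in which both paths are line segments. -/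
def orderConvexShape {n : ℕ} (P Q : LatticePath n) : Set (ℤ × ℤ) :=
  {b | InRegion P Q b ∧ InRegion P Q (b + (1, 0)) ∧ InRegion P Q (b + (0, 1)) ∧
       InRegion P Q (b + (1, 1))}

/-- `L` lists the boxes of `S` in the order of a linear extension of the partial order
`(x, y) ≤ (x', y') ↔ x ≤ x' ∧ y ≤ y'`. -/
def IsLinearExtension (S : Set (ℤ × ℤ)) (L : List (ℤ × ℤ)) : Prop :=
  L.Nodup ∧ (∀ b, b ∈ L ↔ b ∈ S) ∧ L.Pairwise fun b b' => ¬ b' ≤ b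

/-- The word of contents `x - y` of a list of boxes. All boxes of an order-convex shape have
content in `{1, …, n - 1}`. -/
def contentWord (L : List (ℤ × ℤ)) : List ℕ :=
  L.map fun b => (b.1 - b.2).toNat

/-- The function `θ_Λ` such that the scaled path `(1/n) Λ` is the curve
`z ↦ (θ_Λ z, θ_Λ z - z)`, `0 ≤ z ≤ 1`. On `[i/n, (i+1)/n]` it interpolates linearly between
`x_i / n` and `x_{i+1} / n`, where `x_i` is the `x`-coordinate of the `i`-th vertex. -/
noncomputable def LatticePath.theta {n : ℕ} (P : LatticePath n) (z : ℝ) : ℝ :=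
  (((P.pt 0).1 : ℝ) +
    ∑ i : Fin n, (((P.pt i.succ).1 : ℝ) - ((P.pt i.castSucc).1 : ℝ)) *
      max 0 (min 1 (n * z - (i : ℕ)))) / n

/-! ### Limit shapes and the limiting height function -/

/-- `θ` (restricted to `[0,1]`) is continuous and piecewise smooth, and its derivative lies in
`[0,1]` wherever it exists. Piecewise smoothness is used in the weakest usual sense: away from a
finite set of points of `(0,1)`, the function is continuously differentiable. -/
def IsBoundary (θ : ℝ → ℝ) : Prop :=
  ContinuousOn θ (Set.Icc 0 1) ∧
  (∃ F : Finset ℝ, ContDiffOn ℝ 1 θ (Set.Ioo 0 1 \ (F : Set ℝ))) ∧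
  ∀ z ∈ Set.Icc (0 : ℝ) 1, ∀ d : ℝ, HasDerivWithinAt θ d (Set.Icc 0 1) z → d ∈ Set.Icc (0 : ℝ) 1

/-- The function `f_p^{φ,ψ}`. -/
noncomputable def fFun (p : ℝ) (φ ψ : ℝ → ℝ) (x y : ℝ) : ℝ :=
  1 / p * ((2 - p) * (ψ x - φ y) + y - x -
    2 * Real.sqrt ((1 - p) * (ψ x - φ y) * (ψ x - φ y - x + y)))

/-- The function `h_p^{φ,ψ}`. -/
noncomputable def hFun (p : ℝ) (φ ψ : ℝ → ℝ) (x y : ℝ) : ℝ :=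
  min (max (max 0 (y - x)) (fFun p φ ψ x y)) (min (1 - x) y)

/-! ### Measurable structure on the finite set of permutations -/

/-- All sets of permutations are measurable. -/
instance instMeasurableSpacePermFin (n : ℕ) : MeasurableSpace (Equiv.Perm (Fin n)) := ⊤

/-! Fix a height b and let h(i) count the positions at or after i carrying a value below b. Applying
τ_i leaves h unchanged away from i and replaces h(i) by min(h(i-1), h(i+1) + 1)
(`discreteHeight_tau_self`). This rule is linear over the (min,+) semiring, so after a whole word
the new height at i is a minimum over j of the old h(j) plus a kernel that does not depend on the
initial permutation.

For the word of an order-convex shape the kernel is explicit: `discreteKernel` depends only on the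
lower path at j and on the upper boundary at i. Boxes are added one at a time along the linear
extension. The kernel obeys the same local recursion as the heights (`IsKernelMin.step`); for the
empty shape the formula says only that h is decreasing with drops of at most 1
(`isKernelMin_initial`). The result is the exact finite formula `isKernelMin_tauWord`.

The scaling limit is then a perturbation argument. Continuous heights differ from the scaled
discrete ones by O(1/n), and every function of the minimizing variable is Lipschitz up to O(1/n), so
pointwise convergence on a dense set is already uniform (`eventually_forall_abs_sub_le_of_dense`)
and passes through the minimum (`tendsto_heightFunction_tauWord`).

It remains to supply convergence of the initial heights. Under weak convergence, rectangles are
continuity sets of a permuton. For uniform random permutations, the events u(k) ∈ B are negatively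
correlated, so a Chernoff bound with Borel–Cantelli gives almost sure convergence, first on a
countable dense set. -/

/-! ### Discrete height functions and the operators `τ_i` -/

/-- The number of positions `k ≥ i` whose value is less than `b` (positions and values are
numbered from `0`). -/
def discreteHeight {n : ℕ} (u : Equiv.Perm (Fin n)) (b i : ℕ) : ℕ :=
  (Finset.univ.filter fun k : Fin n => i ≤ (k : ℕ) ∧ (u k : ℕ) < b).card

theorem discreteHeight_eq_succ {n : ℕ} (u : Equiv.Perm (Fin n)) (b : ℕ) (k : Fin n) :
    discreteHeight u b k = discreteHeight u b (k + 1) + if (u k : ℕ) < b then 1 else 0 := by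
  unfold discreteHeight
  split_ifs with h
  · rw [← Finset.card_insert_of_notMem (a := k)]
    · congr 1
      ext j
      simp only [Finset.mem_filter, Finset.mem_univ, true_and, Finset.mem_insert, Fin.ext_iff]
      constructor
      · rintro ⟨h1, h2⟩
        by_cases hj : (j : ℕ) = k
        · exact Or.inl hj
        · exact Or.inr ⟨by omega, h2⟩
      · rintro (h1 | h1)
        · have : j = k := Fin.ext h1
          subst this
          exact ⟨le_refl _, h⟩
        · exact ⟨by omega, h1.2⟩
    · simp
  · rw [Nat.add_zero]
    congr 1
    ext j
    simp only [Finset.mem_filter, Finset.mem_univ, true_and]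
    constructor
    · rintro ⟨h1, h2⟩
      refine ⟨?_, h2⟩
      rcases Nat.lt_or_ge (k : ℕ) j with h3 | h3
      · exact h3
      · have : j = k := Fin.ext (by omega)
        subst this
        exact absurd h2 h
    · rintro ⟨h1, h2⟩
      exact ⟨by omega, h2⟩

theorem discreteHeight_succ_le {n : ℕ} (u : Equiv.Perm (Fin n)) (b i : ℕ) :
    discreteHeight u b (i + 1) ≤ discreteHeight u b i := by
  apply Finset.card_le_card
  intro k
  simp only [Finset.mem_filter, Finset.mem_univ, true_and]
  omega

theorem discreteHeight_le_succ_add_one {n : ℕ} (u : Equiv.Perm (Fin n)) (b i : ℕ) :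
    discreteHeight u b i ≤ discreteHeight u b (i + 1) + 1 := by
  by_cases hi : i < n
  · have := discreteHeight_eq_succ u b ⟨i, hi⟩
    simp only at this
    split_ifs at this <;> omega
  · rw [discreteHeight, Finset.card_eq_zero.2]
    · omega
    · rw [Finset.filter_eq_empty_iff]
      intro k _ h
      have := k.isLt
      omega

theorem discreteHeight_antitone {n : ℕ} (u : Equiv.Perm (Fin n)) (b : ℕ) :
    Antitone (discreteHeight u b) :=
  antitone_nat_of_succ_le fun i => discreteHeight_succ_le u b i

theorem discreteHeight_le_add_sub {n : ℕ} (u : Equiv.Perm (Fin n)) (b : ℕ) {i j : ℕ}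
    (hij : i ≤ j) : discreteHeight u b i ≤ discreteHeight u b j + (j - i) := by
  induction j, hij using Nat.le_induction with
  | base => omega
  | succ j hj ih =>
    have := discreteHeight_le_succ_add_one u b j
    omega

/-- Since inversions are recorded as pairs of values, the inversion set of `u` is literally
contained in that of `u * swap p q`: exchanging adjacent positions changes the relative order of the
two values there and of no other pair. The pair `(u p, u q)` is the new inversion. -/
theorem invCount_lt_mul_swap {n : ℕ} (u : Equiv.Perm (Fin n)) {p q : Fin n}
    (hpq : (q : ℕ) = p + 1) (h : u p < u q) : invCount u < invCount (u * Equiv.swap p q) := by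
  apply Finset.card_lt_card
  have hinv_self : ∀ x, u⁻¹ (u x) = x := u.symm_apply_apply
  have hne : p ≠ q := by
    rintro rfl
    omega
  rw [Finset.ssubset_iff_of_subset]
  · refine ⟨(u p, u q), ?_, ?_⟩
    · simp only [Finset.mem_filter, Finset.mem_univ, true_and, mul_inv_rev, Equiv.swap_inv,
        Equiv.Perm.mul_apply, hinv_self, Equiv.swap_apply_left,
        Equiv.swap_apply_right]
      exact ⟨h, by rw [Fin.lt_def]; omega⟩
    · simp only [Finset.mem_filter, Finset.mem_univ, true_and, hinv_self,
        not_and, not_lt, Fin.le_def]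
      omega
  · rintro ⟨a, b⟩
    simp only [Finset.mem_filter, Finset.mem_univ, true_and, mul_inv_rev, Equiv.swap_inv,
      Equiv.Perm.mul_apply]
    rintro ⟨hab, hinv⟩
    refine ⟨hab, ?_⟩
    obtain ⟨x, rfl⟩ := u.surjective a
    obtain ⟨y, rfl⟩ := u.surjective b
    simp only [hinv_self] at hinv ⊢
    have hx : ¬ (x = q ∧ y = p) := by
      rintro ⟨rfl, rfl⟩
      exact absurd hab (not_lt.2 h.le)
    rw [Equiv.swap_apply_def, Equiv.swap_apply_def]
    simp only [Fin.lt_def, Fin.ext_iff] at hx hinv ⊢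
    split_ifs <;> omega

theorem invCount_lt_mul_swap_iff {n : ℕ} (u : Equiv.Perm (Fin n)) {p q : Fin n}
    (hpq : (q : ℕ) = p + 1) : invCount u < invCount (u * Equiv.swap p q) ↔ u p < u q := by
  refine ⟨fun h => ?_, invCount_lt_mul_swap u hpq⟩
  by_contra hlt
  have hne : p ≠ q := by
    rintro rfl
    omega
  have hlt' : u q < u p :=
    lt_of_le_of_ne (not_lt.1 hlt) fun he => hne (u.injective he).symm
  have := invCount_lt_mul_swap (u * Equiv.swap p q) hpq (by simpa using hlt')
  rw [mul_assoc, Equiv.swap_mul_self, mul_one] at this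
  omega

/-- Only the threshold `j = q` separates the adjacent positions `p` and `q`; for any other `j` the
swap is a bijection between the two counted sets. -/
theorem discreteHeight_mul_swap_of_ne {n : ℕ} (u : Equiv.Perm (Fin n)) (b : ℕ) {p q : Fin n}
    (hpq : (q : ℕ) = p + 1) {j : ℕ} (hj : j ≠ q) :
    discreteHeight (u * Equiv.swap p q) b j = discreteHeight u b j := by
  unfold discreteHeight
  refine Finset.card_bij' (fun k _ => Equiv.swap p q k) (fun k _ => Equiv.swap p q k)
    ?_ ?_ ?_ ?_
  · intro k hk
    rw [Finset.mem_filter] at hk ⊢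
    simp only [Finset.mem_univ, true_and, Equiv.Perm.mul_apply] at hk ⊢
    refine ⟨?_, hk.2⟩
    rw [Equiv.swap_apply_def]
    simp only [Fin.ext_iff]
    split_ifs <;> omega
  · intro k hk
    rw [Finset.mem_filter] at hk ⊢
    simp only [Finset.mem_univ, true_and, Equiv.Perm.mul_apply, Equiv.swap_apply_self] at hk ⊢
    refine ⟨?_, hk.2⟩
    rw [Equiv.swap_apply_def]
    simp only [Fin.ext_iff]
    split_ifs <;> omega
  · intro k _
    exact Equiv.swap_apply_self _ _ _
  · intro k _
    exact Equiv.swap_apply_self _ _ _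

theorem tau_eq {n : ℕ} (u : Equiv.Perm (Fin n)) {p q : Fin n} (hpq : (q : ℕ) = p + 1) :
    tau q u = if u p < u q then u * Equiv.swap p q else u := by
  have hs : simpleTransposition n q = Equiv.swap p q := by
    rw [simpleTransposition, dif_pos ⟨by omega, q.isLt⟩]
    congr 1
    exact Fin.ext (by simp [hpq])
  simp only [tau, hs, invCount_lt_mul_swap_iff u hpq]

theorem discreteHeight_tau_of_ne {n : ℕ} (u : Equiv.Perm (Fin n)) (b : ℕ) {i j : ℕ}
    (hi : 0 < i) (hin : i < n) (hj : j ≠ i) :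
    discreteHeight (tau i u) b j = discreteHeight u b j := by
  have h : tau i u = _ :=
    tau_eq u (p := ⟨i - 1, by omega⟩) (q := ⟨i, hin⟩) (by simp; omega)
  rw [h]
  split_ifs
  · exact discreteHeight_mul_swap_of_ne u b (by simp; omega) hj
  · rfl

/-- After τ the smaller of the two adjacent values sits at position `i + 1`. It contributes 1
exactly when at least one of them is below `b`, that is, min(1, c), where c of them are below `b`
and `discreteHeight u b i = discreteHeight u b (i + 2) + c`. -/
theorem discreteHeight_tau_self {n : ℕ} (u : Equiv.Perm (Fin n)) (b : ℕ) {i : ℕ}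
    (hin : i + 1 < n) :
    discreteHeight (tau (i + 1) u) b (i + 1) =
      min (discreteHeight u b i) (discreteHeight u b (i + 2) + 1) := by
  have h : tau (i + 1) u = _ :=
    tau_eq u (p := ⟨i, by omega⟩) (q := ⟨i + 1, hin⟩) rfl
  have h2 := discreteHeight_tau_of_ne u b (i := i + 1) (j := i + 2) (by omega) hin (by omega)
  have e1 := discreteHeight_eq_succ (tau (i + 1) u) b ⟨i + 1, hin⟩
  have e2 := discreteHeight_eq_succ u b ⟨i + 1, hin⟩
  have e3 := discreteHeight_eq_succ u b ⟨i, by omega⟩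
  simp only [add_assoc, Nat.reduceAdd] at e1 e2 e3
  rw [h2, h] at e1
  rw [h, e1, e3, e2]
  by_cases hlt : u ⟨i, by omega⟩ < u ⟨i + 1, hin⟩
  · rw [if_pos hlt]
    simp only [Equiv.Perm.mul_apply, Equiv.swap_apply_right]
    rw [Fin.lt_def] at hlt
    split_ifs <;> omega
  · rw [if_neg hlt]
    rw [Fin.lt_def] at hlt
    split_ifs <;> omega

/-! ### Lattice paths and shapes -/

/-- The `x`-coordinate of the vertex of a lattice path on the line `x - y = i`. -/
def LatticePath.abscissa {n : ℕ} (P : LatticePath n) (i : ℕ) : ℤ :=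
  if h : i < n + 1 then (P.pt ⟨i, h⟩).1 else 0

theorem LatticePath.abscissa_coe {n : ℕ} (P : LatticePath n) (i : Fin (n + 1)) :
    P.abscissa i = (P.pt i).1 := by
  simp [LatticePath.abscissa, i.isLt]

theorem LatticePath.abscissa_succ {n : ℕ} (P : LatticePath n) {i : ℕ} (hi : i < n) :
    P.abscissa (i + 1) = P.abscissa i + 1 ∨ P.abscissa (i + 1) = P.abscissa i := by
  have h1 := P.abscissa_coe (Fin.succ ⟨i, hi⟩)
  have h2 := P.abscissa_coe (Fin.castSucc ⟨i, hi⟩)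
  simp only [Fin.val_succ, Fin.val_castSucc] at h1 h2
  rw [h1, h2]
  rcases P.step ⟨i, hi⟩ with h | h
  · left
    rw [h]
    simp
  · right
    rw [h]
    simp

theorem inRegion_iff {n : ℕ} (P Q : LatticePath n) (p : ℤ × ℤ) :
    InRegion P Q p ↔
      ∃ i : ℕ, i ≤ n ∧ p.1 - p.2 = i ∧ P.abscissa i ≤ p.1 ∧ p.1 ≤ Q.abscissa i := by
  constructor
  · rintro ⟨i, h⟩
    refine ⟨i, by omega, ?_⟩
    rwa [P.abscissa_coe, Q.abscissa_coe]
  · rintro ⟨i, hi, h⟩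
    refine ⟨⟨i, by omega⟩, ?_⟩
    rwa [← P.abscissa_coe, ← Q.abscissa_coe]

/-- The lower-left and upper-right vertices lie on the line `x - y = i` and give the two
inequalities. The other two vertices lie on the neighbouring lines, which forces `0 < i < n`; their
own inequalities follow because the paths move by unit steps. -/
theorem mem_orderConvexShape_iff {n : ℕ} (P Q : LatticePath n) (x y : ℤ) :
    (x, y) ∈ orderConvexShape P Q ↔
      ∃ i : ℕ, 0 < i ∧ i < n ∧ x - y = i ∧ P.abscissa i ≤ x ∧ x < Q.abscissa i := by
  simp only [orderConvexShape, Set.mem_ofPred_eq, inRegion_iff, Prod.mk_add_mk]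
  constructor
  · rintro ⟨⟨i, h1, h2, h3, h4⟩, ⟨j, h5, h6, h7, h8⟩, ⟨k, h9, h10, h11, h12⟩,
      ⟨l, h13, h14, h15, h16⟩⟩
    have : l = i := by omega
    subst this
    exact ⟨l, by omega, by omega, h2, h3, by omega⟩
  · rintro ⟨i, h1, h2, h3, h4, h5⟩
    obtain ⟨k, rfl⟩ : ∃ k, i = k + 1 := ⟨i - 1, by omega⟩
    have a1 := P.abscissa_succ (i := k) (by omega)
    have a2 : P.abscissa (k + 2) = _ ∨ P.abscissa (k + 2) = _ :=
      P.abscissa_succ (i := k + 1) (by omega)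
    have b1 := Q.abscissa_succ (i := k) (by omega)
    have b2 : Q.abscissa (k + 2) = _ ∨ Q.abscissa (k + 2) = _ :=
      Q.abscissa_succ (i := k + 1) (by omega)
    push_cast at *
    exact ⟨⟨k + 1, by omega, by push_cast; omega, by omega, by omega⟩,
      ⟨k + 2, by omega, by push_cast; omega, by omega, by omega⟩,
      ⟨k, by omega, by omega, by omega, by omega⟩,
      ⟨k + 1, by omega, by push_cast; omega, by omega, by omega⟩⟩

/-! ### The discrete variational formula -/

/-- The discrete analogue of `hFun 1`, for a lower boundary with abscissas `P` and an upper
boundary whose vertex on the line `x - y = i` has abscissa `a`. -/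
def discreteKernel (n : ℕ) (P : ℕ → ℤ) (a : ℤ) (i j : ℕ) : ℤ :=
  min (max (max 0 ((j : ℤ) - i)) (a - P j + j - i)) (min ((n : ℤ) - i) j)

/-- `g` is the minimum over `0 ≤ j ≤ n` of `h j + discreteKernel n P a i j`. -/
def IsKernelMin (n : ℕ) (h : ℕ → ℕ) (P : ℕ → ℤ) (a : ℤ) (i : ℕ) (g : ℤ) : Prop :=
  (∀ j ≤ n, g ≤ h j + discreteKernel n P a i j) ∧
    ∃ j ≤ n, g = h j + discreteKernel n P a i j

theorem IsKernelMin.step {n : ℕ} {h : ℕ → ℕ} {P : ℕ → ℤ} {a : ℤ} {i : ℕ} {g₁ g₂ : ℤ}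
    (hi : i + 1 < n) (ha : P (i + 1) ≤ a)
    (h₁ : IsKernelMin n h P a i g₁) (h₂ : IsKernelMin n h P (a + 1) (i + 2) g₂) :
    IsKernelMin n h P (a + 1) (i + 1) (min g₁ (g₂ + 1)) := by
  -- The kernel, as a function of the boundary, satisfies the same recursion as the heights. The
  -- hypothesis `P (i + 1) ≤ a` matters at `j = i + 1`, where it makes the term involving `P`
  -- dominate the other two in each maximum.
  have key : ∀ j, discreteKernel n P (a + 1) (i + 1) j =
      min (discreteKernel n P a i j) (discreteKernel n P (a + 1) (i + 2) j + 1) := by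
    intro j
    unfold discreteKernel
    push_cast
    rcases lt_trichotomy j (i + 1) with hj | hj | hj
    · omega
    · subst hj
      push_cast
      omega
    · omega
  obtain ⟨l₁, j₁, hj₁, e₁⟩ := h₁
  obtain ⟨l₂, j₂, hj₂, e₂⟩ := h₂
  refine ⟨fun j hj => ?_, ?_⟩
  · have := key j
    have := l₁ j hj
    have := l₂ j hj
    omega
  · rcases le_total g₁ (g₂ + 1) with hg | hg
    · refine ⟨j₁, hj₁, ?_⟩
      have := key j₁
      have := l₂ j₁ hj₁
      omega
    · refine ⟨j₂, hj₂, ?_⟩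
      have := key j₂
      have := l₁ j₂ hj₂
      omega

section

variable {n : ℕ} {h : ℕ → ℕ} {P : ℕ → ℤ}

/-- For `i, j` in `[0, n]` the kernel is at least max(0, j - i), because this quantity never exceeds
min(n - i, j). So monotonicity and the bound on drops give the inequality, and the kernel vanishes
at `j = i` when `a = P i`. -/
theorem isKernelMin_initial (h_anti : Antitone h) (h_lip : ∀ i j, i ≤ j → h i ≤ h j + (j - i)) {i : ℕ} (hi : i ≤ n) : IsKernelMin n h P (P i) i (h i) := by
  have hin := h_lip i n hi
  have h0 := h_anti (Nat.zero_le i)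
  refine ⟨fun j hj => ?_, i, hi, by unfold discreteKernel; omega⟩
  have hj0 := h_lip 0 j (Nat.zero_le j)
  unfold discreteKernel
  rcases le_total i j with hij | hij
  · have := h_lip i j hij
    omega
  · have := h_anti hij
    omega

/-- The outer truncation decides: the kernel equals `j` for `i = 0` and 0 for `i = n`. No box has
content 0 or n, so there the boundary never moves, and this lemma lets the induction assign it any
abscissa. -/
theorem discreteKernel_eq_of_boundary {i j : ℕ} (hi : i = 0 ∨ i = n) (hj : j ≤ n) (a a' : ℤ) :
    discreteKernel n P a i j = discreteKernel n P a' i j := by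
  unfold discreteKernel
  omega

theorem IsKernelMin.of_boundary {i : ℕ} (hi : i = 0 ∨ i = n) {a : ℤ} (a' : ℤ) {g : ℤ}
    (hg : IsKernelMin n h P a i g) : IsKernelMin n h P a' i g := by
  obtain ⟨l, j, hj, e⟩ := hg
  refine ⟨fun k hk => ?_, j, hj, ?_⟩
  · rw [discreteKernel_eq_of_boundary hi hk a' a]
    exact l k hk
  · rw [discreteKernel_eq_of_boundary hi hj a' a]
    exact e

end

theorem tauWord_concat {n : ℕ} (w : List ℕ) (i : ℕ) (v : Equiv.Perm (Fin n)) :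
    tauWord (w ++ [i]) v = tau i (tauWord w v) := by
  simp [tauWord]

/-- The variational formula along a lower set of boxes, listed in the order of a linear
extension: `x` is the abscissa of the vertex on the line `x - y = i` of the boundary of this set. -/
theorem isKernelMin_of_lowerSet {n : ℕ} (P Q : LatticePath n) (v : Equiv.Perm (Fin n)) (b : ℕ)
    (L : List (ℤ × ℤ)) (hsub : ∀ c ∈ L, c ∈ orderConvexShape P Q)
    (hlow : ∀ c ∈ L, ∀ d ∈ orderConvexShape P Q, d ≤ c → d ∈ L)
    (hnodup : L.Nodup) (hpw : L.Pairwise fun c d => ¬ d ≤ c) :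
    ∀ i ≤ n, ∀ x : ℤ, (x = P.abscissa i ∨ (x - 1, x - 1 - i) ∈ L) → (x, x - i) ∉ L →
      IsKernelMin n (discreteHeight v b) P.abscissa x i
        (discreteHeight (tauWord (contentWord L) v) b i) := by
  induction L using List.reverseRecOn with
  | nil =>
    intro i hi x hx _
    have : x = P.abscissa i := by simpa using hx
    subst this
    exact isKernelMin_initial (discreteHeight_antitone v b)
      (fun i j hij => discreteHeight_le_add_sub v b hij) hi
  | append_singleton L c ih =>
    rw [List.pairwise_append] at hpw
    obtain ⟨hpwL, -, hpwc⟩ := hpw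
    replace hpwc : ∀ d ∈ L, ¬ c ≤ d := fun d hd => hpwc d hd c (by simp)
    have hcL : c ∉ L := fun hc => hpwc c hc le_rfl
    have hlow' : ∀ d ∈ orderConvexShape P Q, d ≤ c → d ≠ c → d ∈ L := by
      intro d hd hdc hne
      have := hlow c (by simp) d hd hdc
      simpa [hne] using this
    replace ih := ih (fun d hd => hsub d (by simp [hd])) (fun d hd e he hed => by
      have := hlow d (by simp [hd]) e he hed
      rcases List.mem_append.1 this with h | h
      · exact h
      · rw [List.mem_singleton] at h
        exact absurd (h ▸ hed) (hpwc d hd)) (List.nodup_append.1 hnodup).1 hpwL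
    obtain ⟨a, y⟩ := c
    obtain ⟨i, hi0, hin, hcont, hPa, haQ⟩ :=
      (mem_orderConvexShape_iff P Q a y).1 (hsub _ (by simp))
    obtain rfl : y = a - i := by omega
    have hword : contentWord (L ++ [(a, a - (i : ℤ))]) = contentWord L ++ [i] := by
      simp [contentWord]
    rw [hword]
    simp only [tauWord_concat]
    set u := tauWord (contentWord L) v with hu
    intro k hk x hx hxL
    by_cases hki : k = i
    · subst hki
      -- On the line of the new box `c` the boundary moves from `a` to `a + 1`. If `x ≤ a`, the box
      -- at `x` would be weakly below `c`, hence already in the lower set.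
      have hax : a < x := by
        by_contra hle
        apply hxL
        have hPx : P.abscissa k ≤ x := by
          rcases hx with hx | hx
          · exact hx.ge
          · have h1 := hsub _ hx
            rw [mem_orderConvexShape_iff] at h1
            obtain ⟨j, _, _, h2, h3, _⟩ := h1
            have : j = k := by omega
            subst this
            omega
        refine hlow (a, a - k) (by simp) _ ?_ ⟨by simpa using not_lt.1 hle, ?_⟩
        · rw [mem_orderConvexShape_iff]
          exact ⟨k, hi0, hin, by omega, hPx, by omega⟩
        · simp only
          omega
      have hxa : x = a + 1 := by
        rcases hx with hx | hx
        · omega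
        · rcases List.mem_append.1 hx with h1 | h1
          · exfalso
            apply hpwc _ h1
            constructor
            · simp only
              omega
            · simp only
              omega
          · simp only [List.mem_singleton, Prod.mk.injEq] at h1
            omega
      subst hxa
      obtain ⟨m, rfl⟩ : ∃ m, k = m + 1 := ⟨k - 1, by omega⟩
      have p1 := P.abscissa_succ (i := m) (by omega)
      have p2 : P.abscissa (m + 2) = _ ∨ P.abscissa (m + 2) = _ :=
        P.abscissa_succ (i := m + 1) (by omega)
      have q1 := Q.abscissa_succ (i := m) (by omega)
      have q2 : Q.abscissa (m + 2) = _ ∨ Q.abscissa (m + 2) = _ :=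
        Q.abscissa_succ (i := m + 1) (by omega)
      rw [discreteHeight_tau_self u b hin]
      push_cast
      -- The corners of `c` on the neighbouring lines have abscissas `a` and `a + 1`, and both lie
      -- on the old boundary. The boxes to the left of and below `c` precede it, so they are in `L`
      -- whenever they belong to the shape; the boxes above and to the right exceed `c`, so they are
      -- not in `L`.
      have left : IsKernelMin n (discreteHeight v b) P.abscissa a m (discreteHeight u b m) := by
        have hnot : (a, a - (m : ℤ)) ∉ L := by
          intro hmem
          apply hpwc _ hmem
          constructor
          · exact le_rfl
          · simp only
            omega
        rcases Nat.eq_zero_or_pos m with hm | hm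
        · refine (ih m (by omega) (P.abscissa m) (Or.inl rfl) ?_).of_boundary (Or.inl hm) a
          intro hmem
          have h1 := hsub _ (List.mem_append_left _ hmem)
          rw [mem_orderConvexShape_iff] at h1
          obtain ⟨j, _, _, h2, _, _⟩ := h1
          omega
        · apply ih m (by omega) a _ hnot
          by_cases hPm : a = P.abscissa m
          · exact Or.inl hPm
          · right
            apply hlow'
            · rw [mem_orderConvexShape_iff]
              exact ⟨m, hm, by omega, by omega, by omega, by omega⟩
            · constructor
              · simp only
                omega
              · simp only
                omega
            · simp
      have right : IsKernelMin n (discreteHeight v b) P.abscissa (a + 1) (m + 2)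
          (discreteHeight u b (m + 2)) := by
        have hnot : (a + 1, a + 1 - ((m + 2 : ℕ) : ℤ)) ∉ L := by
          intro hmem
          apply hpwc _ hmem
          constructor
          · simp only
            omega
          · simp only
            omega
        rcases Nat.eq_or_lt_of_le (show m + 2 ≤ n by omega) with hm | hm
        · refine (ih (m + 2) (by omega) (P.abscissa (m + 2)) (Or.inl rfl) ?_).of_boundary
            (Or.inr hm) _
          intro hmem
          have h1 := hsub _ (List.mem_append_left _ hmem)
          rw [mem_orderConvexShape_iff] at h1
          obtain ⟨j, _, _, h2, _, _⟩ := h1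
          omega
        · apply ih (m + 2) (by omega) (a + 1) _ hnot
          by_cases hPm : a + 1 = P.abscissa (m + 2)
          · exact Or.inl hPm
          · right
            apply hlow'
            · rw [mem_orderConvexShape_iff]
              exact ⟨m + 2, by omega, hm, by omega, by omega, by omega⟩
            · constructor
              · simp only
                omega
              · simp only
                omega
            · simp only [ne_eq, Prod.mk.injEq]
              omega
      exact left.step hin hPa right
    · rw [discreteHeight_tau_of_ne u b hi0 hin hki]
      apply ih k hk x
      · rcases hx with hx | hx
        · exact Or.inl hx
        · right
          rcases List.mem_append.1 hx with h1 | h1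
          · exact h1
          · simp only [List.mem_singleton, Prod.mk.injEq] at h1
            omega
      · intro hmem
        exact hxL (List.mem_append_left _ hmem)

/-- The discrete variational formula for the height function of `τ_{𝐰(𝒮)}(v)`. -/
theorem isKernelMin_tauWord {n : ℕ} {P Q : LatticePath n} (hPQ : P.WeaklySW Q)
    {L : List (ℤ × ℤ)} (hL : IsLinearExtension (orderConvexShape P Q) L)
    (v : Equiv.Perm (Fin n)) (b : ℕ) {i : ℕ} (hi : i ≤ n) :
    IsKernelMin n (discreteHeight v b) P.abscissa (Q.abscissa i) i
      (discreteHeight (tauWord (contentWord L) v) b i) := by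
  obtain ⟨hnodup, hmem, hpw⟩ := hL
  have key := isKernelMin_of_lowerSet P Q v b L (fun c hc => (hmem c).1 hc)
    (fun c _ d hd _ => (hmem d).2 hd) hnodup hpw i hi
  have hPQi : P.abscissa i ≤ Q.abscissa i := by
    have := hPQ ⟨i, by omega⟩
    rwa [← P.abscissa_coe, ← Q.abscissa_coe] at this
  by_cases hb : i = 0 ∨ i = n
  · refine (key (P.abscissa i) (Or.inl rfl) ?_).of_boundary hb _
    rw [hmem, mem_orderConvexShape_iff]
    rintro ⟨j, h1, h2, h3, _⟩
    omega
  · push Not at hb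
    apply key
    · by_cases he : Q.abscissa i = P.abscissa i
      · exact Or.inl he
      · right
        rw [hmem, mem_orderConvexShape_iff]
        exact ⟨i, by omega, by omega, by omega, by omega, by omega⟩
    · rw [hmem, mem_orderConvexShape_iff]
      rintro ⟨j, h1, h2, h3, h4, h5⟩
      have : j = i := by omega
      subst this
      omega

/-! ### Comparison of discrete and continuous height functions -/

theorem discreteHeight_value_succ_le {n : ℕ} (u : Equiv.Perm (Fin n)) (b i : ℕ) :
    discreteHeight u (b + 1) i ≤ discreteHeight u b i + 1 := by
  have h1 : (Finset.univ.filter fun k : Fin n => (u k : ℕ) = b).card ≤ 1 := by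
    rw [Finset.card_le_one]
    intro k hk l hl
    simp only [Finset.mem_filter, Finset.mem_univ, true_and] at hk hl
    exact u.injective (Fin.ext (hk.trans hl.symm))
  calc discreteHeight u (b + 1) i
      ≤ ((Finset.univ.filter fun k : Fin n => i ≤ (k : ℕ) ∧ (u k : ℕ) < b) ∪
          Finset.univ.filter fun k : Fin n => (u k : ℕ) = b).card := by
        apply Finset.card_le_card
        intro k
        simp only [Finset.mem_filter, Finset.mem_univ, true_and, Finset.mem_union]
        omega
    _ ≤ _ := (Finset.card_union_le _ _).trans (Nat.add_le_add_left h1 _)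

theorem heightFunction_plotPermuton {n : ℕ} [NeZero n] (u : Equiv.Perm (Fin n)) (x y : I) :
    heightFunction (plotPermuton u) x y =
      ∑ k : Fin n, ((n : ENNReal) *
        (volume : Measure (I × I)) ((Set.Icc x 1 ×ˢ Set.Icc 0 y) ∩ plotSquare u k)).toReal := by
  have hS : MeasurableSet (Set.Icc x 1 ×ˢ Set.Icc 0 y : Set (I × I)) :=
    measurableSet_Icc.prod measurableSet_Icc
  change (plotMeasure u).real _ = _
  rw [Measure.real, plotMeasure, Measure.coe_finsetSum, Finset.sum_apply, ENNReal.toReal_sum]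
  · simp only [Measure.smul_apply, Measure.restrict_apply hS, smul_eq_mul]
  · intro k _
    simp only [Measure.smul_apply, Measure.restrict_apply hS, smul_eq_mul]
    exact ENNReal.mul_ne_top (ENNReal.natCast_ne_top n) (measure_ne_top _ _)

/-- Each square has mass 1/n. Squares with position at least `i + 1` and value below `b` lie inside
the rectangle; those meeting it have position at least `i - 1` and value below `b + 1`, the extra
row and column allowing for partial overlap and shared edges. These counts differ from the one at
`(b, i)` by at most 1 and 2. -/
theorem abs_heightFunction_sub_le {n : ℕ} [NeZero n] (u : Equiv.Perm (Fin n)) (x y : I) :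
    |heightFunction (plotPermuton u) x y -
      (discreteHeight u ⌊(n : ℝ) * y⌋₊ ⌊(n : ℝ) * x⌋₊ : ℝ) / n| ≤ 2 / n := by
  have hn : (0 : ℝ) < n := by exact_mod_cast Nat.pos_of_ne_zero (NeZero.ne n)
  have h0 : (n : ENNReal) ≠ 0 := by exact_mod_cast NeZero.ne n
  have ht : (n : ENNReal) ≠ ⊤ := ENNReal.natCast_ne_top n
  have hx0 : 0 ≤ (n : ℝ) * x := mul_nonneg hn.le x.2.1
  have hy0 : 0 ≤ (n : ℝ) * y := mul_nonneg hn.le y.2.1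
  set i := ⌊(n : ℝ) * x⌋₊ with hi
  set b := ⌊(n : ℝ) * y⌋₊ with hb
  have hi1 : (i : ℝ) ≤ n * x := Nat.floor_le hx0
  have hi2 : (n : ℝ) * x < i + 1 := Nat.lt_floor_add_one _
  have hb1 : (b : ℝ) ≤ n * y := Nat.floor_le hy0
  have hb2 : (n : ℝ) * y < b + 1 := Nat.lt_floor_add_one _
  set S : Set (I × I) := Set.Icc x 1 ×ˢ Set.Icc 0 y with hS
  have hfull : ∀ k, (n : ENNReal) * (volume : Measure (I × I)) (plotSquare u k) =
      (n : ENNReal)⁻¹ := by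
    intro k
    rw [volume_plotSquare, ← mul_assoc, ENNReal.mul_inv_cancel h0 ht, one_mul]
  set r : Fin n → ℝ := fun k =>
    ((n : ENNReal) * (volume : Measure (I × I)) (S ∩ plotSquare u k)).toReal with hr
  have hr_le : ∀ k, r k ≤ 1 / n := by
    intro k
    have h1 : (n : ENNReal) * (volume : Measure (I × I)) (S ∩ plotSquare u k) ≤
        (n : ENNReal)⁻¹ := by
      rw [← hfull k]
      gcongr
      exact Set.inter_subset_right
    have := ENNReal.toReal_mono (ENNReal.inv_ne_top.2 h0) h1
    simpa [hr] using this
  have hr_eq : ∀ k, plotSquare u k ⊆ S → r k = 1 / n := by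
    intro k hk
    simp only [hr, Set.inter_eq_right.2 hk, hfull k]
    simp
  have hr_zero : ∀ k, S ∩ plotSquare u k = ∅ → r k = 0 := by
    intro k hk
    simp only [hr, hk]
    simp
  have hr_nonneg : ∀ k, 0 ≤ r k := fun k => ENNReal.toReal_nonneg
  have hH : heightFunction (plotPermuton u) x y = ∑ k, r k := heightFunction_plotPermuton u x y
  have lower : (discreteHeight u b (i + 1) : ℝ) / n ≤ heightFunction (plotPermuton u) x y := by
    rw [hH]
    calc (discreteHeight u b (i + 1) : ℝ) / n
        = ∑ k ∈ Finset.univ.filter fun k : Fin n => i + 1 ≤ (k : ℕ) ∧ (u k : ℕ) < b,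
            (1 / n : ℝ) := by
          rw [Finset.sum_const, nsmul_eq_mul, discreteHeight]
          ring
      _ ≤ ∑ k ∈ Finset.univ.filter fun k : Fin n => i + 1 ≤ (k : ℕ) ∧ (u k : ℕ) < b, r k := by
          apply Finset.sum_le_sum
          intro k hk
          simp only [Finset.mem_filter, Finset.mem_univ, true_and] at hk
          rw [hr_eq k]
          rintro ⟨p, q⟩ ⟨h1, h2, h3, h4⟩
          have e1 : ((i : ℝ) + 1) ≤ (k : ℕ) := by exact_mod_cast hk.1
          have e2 : ((u k : ℕ) : ℝ) + 1 ≤ b := by exact_mod_cast hk.2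
          simp only at h1 h2 h3 h4
          refine ⟨⟨?_, p.2.2⟩, ⟨q.2.1, ?_⟩⟩
          · rw [← Subtype.coe_le_coe]
            exact le_of_mul_le_mul_left (by linarith) hn
          · rw [← Subtype.coe_le_coe]
            exact le_of_mul_le_mul_left (by linarith) hn
      _ ≤ ∑ k, r k :=
          Finset.sum_le_univ_sum_of_nonneg hr_nonneg
  have upper : heightFunction (plotPermuton u) x y ≤
      (discreteHeight u (b + 1) (i - 1) : ℝ) / n := by
    rw [hH]
    calc ∑ k, r k
        = ∑ k ∈ Finset.univ.filter fun k : Fin n => i - 1 ≤ (k : ℕ) ∧ (u k : ℕ) < b + 1, r k := by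
          symm
          apply Finset.sum_subset (Finset.subset_univ _)
          intro k _ hk
          apply hr_zero
          by_contra hne
          obtain ⟨⟨p, q⟩, ⟨⟨h1, _⟩, ⟨_, h2⟩⟩, ⟨h3, h4, h5, h6⟩⟩ :=
            Set.nonempty_iff_ne_empty.2 hne
          apply hk
          simp only [Finset.mem_filter, Finset.mem_univ, true_and]
          simp only at h1 h2 h3 h4 h5 h6
          have e1 : (n : ℝ) * x ≤ n * p := mul_le_mul_of_nonneg_left h1 hn.le
          have e2 : (n : ℝ) * q ≤ n * y := mul_le_mul_of_nonneg_left h2 hn.le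
          constructor
          · have : (i : ℝ) ≤ ((k : ℕ) + 1 : ℕ) := by push_cast; linarith
            have : i ≤ k + 1 := by exact_mod_cast this
            omega
          · have : ((u k : ℕ) : ℝ) < ((b + 1 : ℕ) : ℝ) := by push_cast; linarith
            exact_mod_cast this
      _ ≤ ∑ k ∈ Finset.univ.filter fun k : Fin n => i - 1 ≤ (k : ℕ) ∧ (u k : ℕ) < b + 1,
            (1 / n : ℝ) := Finset.sum_le_sum fun k _ => hr_le k
      _ = _ := by
          rw [Finset.sum_const, nsmul_eq_mul, discreteHeight]
          ring
  have d1 := discreteHeight_le_succ_add_one u b i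
  have d2 : discreteHeight u (b + 1) (i - 1) ≤ discreteHeight u b i + 2 := by
    have e1 := discreteHeight_le_add_sub u (b + 1) (i := i - 1) (j := i) (by omega)
    have e2 := discreteHeight_value_succ_le u b i
    omega
  have d1' : (discreteHeight u b i : ℝ) ≤ discreteHeight u b (i + 1) + 1 := by exact_mod_cast d1
  have d2' : (discreteHeight u (b + 1) (i - 1) : ℝ) ≤ discreteHeight u b i + 2 := by
    exact_mod_cast d2
  rw [abs_le]
  constructor
  · have : (discreteHeight u b i : ℝ) / n - 2 / n ≤ (discreteHeight u b (i + 1) : ℝ) / n := by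
      rw [← sub_div]
      gcongr
      linarith
    linarith
  · have : (discreteHeight u (b + 1) (i - 1) : ℝ) / n ≤ (discreteHeight u b i : ℝ) / n + 2 / n := by
      rw [← add_div]
      gcongr
    linarith

theorem abs_heightFunction_plotPermuton_sub_le {n : ℕ} [NeZero n] (u : Equiv.Perm (Fin n))
    (y s t : I) :
    |heightFunction (plotPermuton u) s y - heightFunction (plotPermuton u) t y| ≤
      dist s t + 5 / n := by
  wlog hst : s ≤ t generalizing s t
  · rw [abs_sub_comm, dist_comm]
    exact this t s (le_of_not_ge hst)
  have hn : (0 : ℝ) < n := by exact_mod_cast Nat.pos_of_ne_zero (NeZero.ne n)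
  have hs := abs_heightFunction_sub_le u s y
  have ht := abs_heightFunction_sub_le u t y
  set b := ⌊(n : ℝ) * y⌋₊
  have hs1 : (⌊(n : ℝ) * s⌋₊ : ℝ) ≤ n * s := Nat.floor_le (mul_nonneg hn.le s.2.1)
  have ht1 : (⌊(n : ℝ) * t⌋₊ : ℝ) ≤ n * t := Nat.floor_le (mul_nonneg hn.le t.2.1)
  have hs2 : (n : ℝ) * s < ⌊(n : ℝ) * s⌋₊ + 1 := Nat.lt_floor_add_one _
  have hij : ⌊(n : ℝ) * s⌋₊ ≤ ⌊(n : ℝ) * t⌋₊ := by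
    apply Nat.floor_le_floor
    exact mul_le_mul_of_nonneg_left hst hn.le
  set i := ⌊(n : ℝ) * s⌋₊
  set j := ⌊(n : ℝ) * t⌋₊
  have h1 : (discreteHeight u b j : ℝ) ≤ discreteHeight u b i := by
    exact_mod_cast discreteHeight_antitone u b hij
  have h2 : (discreteHeight u b i : ℝ) ≤ discreteHeight u b j + (j - i) := by
    have := discreteHeight_le_add_sub u b hij
    have h : (discreteHeight u b i : ℝ) ≤ (discreteHeight u b j + (j - i) : ℕ) := by
      exact_mod_cast this
    rwa [Nat.cast_add, Nat.cast_sub hij] at h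
  have hd : dist s t = t - s := by
    rw [Subtype.dist_eq, Real.dist_eq, abs_sub_comm, abs_of_nonneg]
    exact sub_nonneg.2 hst
  have h3 : (discreteHeight u b i : ℝ) / n ≤ (discreteHeight u b j : ℝ) / n + ((t : ℝ) - s)
      + 1 / n := by
    have : (t : ℝ) - s = (n * t - n * s) / n := by field_simp
    rw [this, ← add_div, ← add_div]
    gcongr
    linarith
  have h4 : (discreteHeight u b j : ℝ) / n ≤ (discreteHeight u b i : ℝ) / n := by
    gcongr
  -- Twice 2/n for discretizing the heights, and 1/n for rounding the two positions.
  have h5 : (5 : ℝ) / n = 2 / n + 2 / n + 1 / n := by ring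
  have h6 : (0 : ℝ) < 1 / n := by positivity
  have h7 : (s : ℝ) ≤ t := hst
  rw [abs_le] at hs ht ⊢
  rw [hd, h5]
  constructor <;> linarith [hs.1, hs.2, ht.1, ht.2]

/-! ### From pointwise to uniform convergence -/

/-- An Arzelà–Ascoli argument: control on a finite ε/4-net drawn from `D` spreads to the whole
compact space. The four quarters are the net radius for `F i`, its error `e i`, the net radius for
`f`, and the error at the net point. -/
theorem eventually_forall_abs_sub_le_of_dense {ι X : Type*} [PseudoMetricSpace X] [CompactSpace X]
    {l : Filter ι} {D : Set X} (hD : Dense D) {F : ι → X → ℝ} {f : X → ℝ} {e : ι → ℝ}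
    (he : Tendsto e l (𝓝 0)) (hF : ∀ i s t, |F i s - F i t| ≤ dist s t + e i)
    (hf : ∀ s t, |f s - f t| ≤ dist s t) (hlim : ∀ d ∈ D, Tendsto (fun i => F i d) l (𝓝 (f d)))
    {ε : ℝ} (hε : 0 < ε) : ∀ᶠ i in l, ∀ t, |F i t - f t| ≤ ε := by
  obtain ⟨B, hBD, hBfin, hBcov⟩ := isCompact_univ.elim_finite_subcover_image
    (b := D) (c := fun d => Metric.ball d (ε / 4)) (fun d _ => Metric.isOpen_ball) (by
      intro t _
      obtain ⟨d, hd, hdt⟩ := hD.exists_dist_lt t (show 0 < ε / 4 by positivity)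
      exact Set.mem_biUnion hd hdt)
  have h1 : ∀ᶠ i in l, ∀ d ∈ B, |F i d - f d| ≤ ε / 4 := by
    rw [eventually_all_finite hBfin]
    intro d hd
    filter_upwards [Metric.tendsto_nhds.1 (hlim d (hBD hd)) (ε / 4) (by positivity)] with i hi
    exact hi.le
  have h2 : ∀ᶠ i in l, e i ≤ ε / 4 :=
    he.eventually_le_const (by positivity)
  filter_upwards [h1, h2] with i h1 h2 t
  obtain ⟨d, hd, hdt⟩ := Set.mem_iUnion₂.1 (hBcov (Set.mem_univ t))
  have hdt' : dist t d < ε / 4 := hdt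
  have a1 := hF i t d
  have a2 := hf t d
  have a3 := h1 d hd
  rw [abs_le] at *
  constructor <;> linarith [a1.1, a1.2, a2.1, a2.2, a3.1, a3.2]

/-! ### The functions `θ_Λ` -/

theorem sum_range_clamp (n : ℕ) (t : ℝ) :
    ∑ i ∈ Finset.range n, max 0 (min 1 (t - (i : ℝ))) = max 0 (min (n : ℝ) t) := by
  induction n with
  | zero => simp
  | succ n ih =>
    rw [Finset.sum_range_succ, ih]
    push_cast
    have hn : (0 : ℝ) ≤ n := n.cast_nonneg
    rcases le_total t n with h | h
    · rw [min_eq_right h, min_eq_right (by linarith : t - n ≤ 1), min_eq_right (by linarith),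
        max_eq_left (by linarith : t - n ≤ 0), add_zero]
    · rw [min_eq_left h, max_eq_right hn, max_eq_right (by
        apply le_min <;> linarith), max_eq_right (by apply le_min <;> linarith),
        ← min_add_add_left]
      congr 1
      ring

theorem LatticePath.theta_eq {n : ℕ} (P : LatticePath n) (z : ℝ) :
    P.theta z = ((P.abscissa 0 : ℝ) + ∑ i ∈ Finset.range n,
      ((P.abscissa (i + 1) : ℝ) - P.abscissa i) * max 0 (min 1 (n * z - (i : ℝ)))) / n := by
  rw [LatticePath.theta, ← Fin.sum_univ_eq_sum_range fun i : ℕ =>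
    ((P.abscissa (i + 1) : ℝ) - P.abscissa i) * max 0 (min 1 (n * z - (i : ℝ)))]
  have h0 : P.abscissa 0 = (P.pt 0).1 := P.abscissa_coe 0
  rw [h0]
  congr 2
  apply Finset.sum_congr rfl
  intro i _
  rw [← P.abscissa_coe, ← P.abscissa_coe, Fin.val_succ, Fin.val_castSucc]

theorem LatticePath.theta_div {n : ℕ} (hn : 0 < n) (P : LatticePath n) {j : ℕ} (hj : j ≤ n) :
    P.theta ((j : ℝ) / n) = (P.abscissa j : ℝ) / n := by
  have hn' : (n : ℝ) ≠ 0 := by positivity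
  rw [P.theta_eq, mul_div_cancel₀ _ hn']
  congr 1
  have h1 : ∀ i ∈ Finset.range n, ((P.abscissa (i + 1) : ℝ) - P.abscissa i) *
      max 0 (min 1 ((j : ℝ) - (i : ℝ))) =
      if i < j then (P.abscissa (i + 1) : ℝ) - P.abscissa i else 0 := by
    intro i _
    split_ifs with h
    · have : (i : ℝ) + 1 ≤ j := by exact_mod_cast h
      rw [min_eq_left (by linarith), max_eq_right zero_le_one, mul_one]
    · have : (j : ℝ) ≤ i := by exact_mod_cast not_lt.1 h
      rw [max_eq_left ((min_le_right _ _).trans (by linarith)), mul_zero]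
  have h2 : (Finset.range n).filter (· < j) = Finset.range j := by
    ext i
    simp only [Finset.mem_filter, Finset.mem_range]
    omega
  rw [Finset.sum_congr rfl h1, ← Finset.sum_filter, h2,
    Finset.sum_range_sub fun i => (P.abscissa i : ℝ)]
  ring

/-- The increments of the abscissa are 0 or 1, so θ is monotone and grows no faster than the sum of
the unit clamps, which by `sum_range_clamp` is `n * z` clamped to `[0, n]`. -/
theorem LatticePath.abs_theta_sub_le {n : ℕ} (P : LatticePath n) (w z : ℝ) :
    |P.theta w - P.theta z| ≤ |w - z| := by
  wlog hwz : w ≤ z generalizing w z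
  · rw [abs_sub_comm, abs_sub_comm w]
    exact this z w (le_of_not_ge hwz)
  rcases Nat.eq_zero_or_pos n with h0 | hn
  · subst h0
    simp [LatticePath.theta]
  have hn' : (0 : ℝ) < n := by exact_mod_cast hn
  set c : ℝ → ℕ → ℝ := fun t i => max 0 (min 1 (n * t - (i : ℝ))) with hc
  have hmono : ∀ i, c w i ≤ c z i := by
    intro i
    simp only [hc]
    gcongr
  have hd : ∀ i ∈ Finset.range n, (0 : ℝ) ≤ (P.abscissa (i + 1) : ℝ) - P.abscissa i ∧
      (P.abscissa (i + 1) : ℝ) - P.abscissa i ≤ 1 := by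
    intro i hi
    rcases P.abscissa_succ (Finset.mem_range.1 hi) with h | h <;> rw [h] <;> push_cast <;>
      constructor <;> linarith
  have hdiff : P.theta z - P.theta w = (∑ i ∈ Finset.range n,
      ((P.abscissa (i + 1) : ℝ) - P.abscissa i) * (c z i - c w i)) / n := by
    rw [P.theta_eq, P.theta_eq, ← sub_div, add_sub_add_left_eq_sub, ← Finset.sum_sub_distrib]
    simp only [hc, mul_sub]
  have hlow : 0 ≤ P.theta z - P.theta w := by
    rw [hdiff]
    apply div_nonneg _ hn'.le
    exact Finset.sum_nonneg fun i hi => mul_nonneg (hd i hi).1 (sub_nonneg.2 (hmono i))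
  have hup : P.theta z - P.theta w ≤ z - w := by
    rw [hdiff, div_le_iff₀ hn']
    calc _ ≤ ∑ i ∈ Finset.range n, (c z i - c w i) :=
          Finset.sum_le_sum fun i hi =>
            mul_le_of_le_one_left (sub_nonneg.2 (hmono i)) (hd i hi).2
      _ = max 0 (min (n : ℝ) (n * z)) - max 0 (min (n : ℝ) (n * w)) := by
          rw [Finset.sum_sub_distrib, sum_range_clamp, sum_range_clamp]
      _ ≤ |max 0 (min (n : ℝ) (n * z)) - max 0 (min (n : ℝ) (n * w))| := le_abs_self _
      _ ≤ |min (n : ℝ) (n * z) - min (n : ℝ) (n * w)| := by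
          simpa using abs_max_sub_max_le_max (0 : ℝ) (min (n : ℝ) (n * z)) 0 (min (n : ℝ) (n * w))
      _ ≤ |n * z - n * w| := by
          simpa using abs_min_sub_min_le_max (n : ℝ) (n * z) n (n * w)
      _ = (z - w) * n := by
          rw [← mul_sub, abs_of_nonneg (mul_nonneg hn'.le (sub_nonneg.2 hwz)), mul_comm]
  rw [abs_sub_comm, abs_sub_comm w, abs_of_nonneg hlow, abs_of_nonneg (sub_nonneg.2 hwz)]
  exact hup

/-! ### The limiting kernel -/

theorem hFun_one (φ ψ : ℝ → ℝ) (x y : ℝ) :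
    hFun 1 φ ψ x y = min (max (max 0 (y - x)) (ψ x - φ y + y - x)) (min (1 - x) y) := by
  have : fFun 1 φ ψ x y = ψ x - φ y + y - x := by
    simp only [fFun, sub_self, zero_mul, Real.sqrt_zero, mul_zero, sub_zero]
    ring
  rw [hFun, this]

theorem abs_min_max_sub_le {a a' f f' c c' d d' δ : ℝ} (hδ : 0 ≤ δ) (ha : |a - a'| ≤ δ)
    (hf : |f - f'| ≤ δ) (hc : |c - c'| ≤ δ) (hd : |d - d'| ≤ δ) :
    |min (max (max 0 a) f) (min c d) - min (max (max 0 a') f') (min c' d')| ≤ δ := by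
  refine (abs_min_sub_min_le_max _ _ _ _).trans (max_le ?_ ?_)
  · refine (abs_max_sub_max_le_max _ _ _ _).trans (max_le ?_ hf)
    refine (abs_max_sub_max_le_max _ _ _ _).trans (max_le ?_ ha)
    simpa using hδ
  · exact (abs_min_sub_min_le_max _ _ _ _).trans (max_le hc hd)

theorem discreteKernel_div {n : ℕ} (hn : 0 < n) (P : ℕ → ℤ) (a : ℤ) (i j : ℕ) :
    (discreteKernel n P a i j : ℝ) / n =
      min (max (max 0 ((j : ℝ) / n - i / n)) ((a : ℝ) / n - P j / n + j / n - i / n))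
        (min (1 - (i : ℝ) / n) (j / n)) := by
  have hn' : (0 : ℝ) < n := by exact_mod_cast hn
  unfold discreteKernel
  push_cast
  rw [← min_div_div_right hn'.le, ← min_div_div_right hn'.le, ← max_div_div_right hn'.le,
    ← max_div_div_right hn'.le, zero_div]
  simp only [sub_div, add_div, div_self hn'.ne']

theorem abs_hFun_one_sub_le {φ ψ : ℝ → ℝ} (hφ : ∀ s t : I, |φ s - φ t| ≤ dist s t)
    (x : ℝ) (s t : I) : |hFun 1 φ ψ x s - hFun 1 φ ψ x t| ≤ 2 * dist s t := by
  have h0 : 0 ≤ dist s t := dist_nonneg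
  have h1 := hφ s t
  have h2 : |(s : ℝ) - t| ≤ dist s t := le_rfl
  rw [hFun_one, hFun_one]
  rw [abs_le] at h1 h2
  apply abs_min_max_sub_le (by linarith) <;> rw [abs_le] <;> constructor <;>
    linarith [h1.1, h1.2, h2.1, h2.2]

/-- The point `j / n` of the unit interval. -/
noncomputable def gridPoint {n j : ℕ} (hj : j ≤ n) : I :=
  ⟨(j : ℝ) / n, by positivity, by
    apply div_le_one_of_le₀ _ n.cast_nonneg
    exact_mod_cast hj⟩

theorem dist_gridPoint_floor {n : ℕ} (hn : 0 < n) (x : I) (h : ⌊(n : ℝ) * x⌋₊ ≤ n) :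
    dist (gridPoint h) x ≤ 1 / n := by
  have hn' : (0 : ℝ) < n := by exact_mod_cast hn
  have h1 : (⌊(n : ℝ) * x⌋₊ : ℝ) ≤ n * x := Nat.floor_le (mul_nonneg hn'.le x.2.1)
  have h2 : (n : ℝ) * x < ⌊(n : ℝ) * x⌋₊ + 1 := Nat.lt_floor_add_one _
  rw [Subtype.dist_eq, Real.dist_eq]
  change |(⌊(n : ℝ) * x⌋₊ : ℝ) / n - x| ≤ 1 / n
  have : (⌊(n : ℝ) * x⌋₊ : ℝ) / n - x = (⌊(n : ℝ) * x⌋₊ - n * x) / n := by field_simp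
  rw [this, abs_div, abs_of_pos hn']
  gcongr
  rw [abs_le]
  constructor <;> linarith

theorem floor_mul_le {n : ℕ} (x : I) : ⌊(n : ℝ) * x⌋₊ ≤ n := by
  apply Nat.floor_le_of_le
  exact mul_le_of_le_one_right n.cast_nonneg x.2.2

theorem floor_mul_gridPoint {n j : ℕ} (hn : 0 < n) (hj : j ≤ n) :
    ⌊(n : ℝ) * gridPoint hj⌋₊ = j := by
  have hn' : (n : ℝ) ≠ 0 := by positivity
  change ⌊(n : ℝ) * ((j : ℝ) / n)⌋₊ = j
  rw [mul_div_cancel₀ _ hn', Nat.floor_natCast]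

/-! ### The scaling limit -/

theorem tendsto_const_div_pnat (c : ℝ) :
    Tendsto (fun n : ℕ+ => c / ((n : ℕ) : ℝ)) atTop (𝓝 0) :=
  (tendsto_const_div_atTop_nhds_zero_nat c).comp tendsto_PNat_val_atTop_atTop

theorem abs_sub_le_of_tendsto_theta {φ : ℝ → ℝ} {P : ∀ n : ℕ+, LatticePath n}
    (h : ∀ z ∈ Set.Icc (0 : ℝ) 1, Tendsto (fun n => (P n).theta z) atTop (𝓝 (φ z))) (s t : I) :
    |φ s - φ t| ≤ dist s t :=
  le_of_tendsto ((h s s.2).sub (h t t.2)).abs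
    (Eventually.of_forall fun n => (P n).abs_theta_sub_le s t)

/-- The scaling limit of the height functions of `τ_{𝐰(𝒮⁽ⁿ⁾)}(v_n)` at height `y`, when the height
functions of `v_n` at height `y` converge to a `1`-Lipschitz function on a dense set. -/
theorem tendsto_heightFunction_tauWord {φ ψ : ℝ → ℝ} {sw ne : ∀ n : ℕ+, LatticePath n}
    (hle : ∀ n, (sw n).WeaklySW (ne n))
    (hsw : ∀ z ∈ Set.Icc (0 : ℝ) 1, Tendsto (fun n => (sw n).theta z) atTop (𝓝 (φ z)))
    (hne : ∀ z ∈ Set.Icc (0 : ℝ) 1, Tendsto (fun n => (ne n).theta z) atTop (𝓝 (ψ z)))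
    {L : ℕ+ → List (ℤ × ℤ)}
    (hL : ∀ n, IsLinearExtension (orderConvexShape (sw n) (ne n)) (L n))
    (v : ∀ n : ℕ+, Equiv.Perm (Fin n)) (x y : I) {f : I → ℝ}
    (hf : ∀ s t, |f s - f t| ≤ dist s t) {D : Set I} (hD : Dense D)
    (hlim : ∀ d ∈ D, Tendsto (fun n => heightFunction (plotPermuton (v n)) d y) atTop (𝓝 (f d)))
    {m : ℝ} (hm : IsLeast (Set.range fun γ : I => f γ + hFun 1 φ ψ x γ) m) :
    Tendsto (fun n => heightFunction (plotPermuton (tauWord (contentWord (L n)) (v n))) x y)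
      atTop (𝓝 m) := by
  -- As a pointwise limit of 1-Lipschitz functions, φ is 1-Lipschitz.
  have hφ := abs_sub_le_of_tendsto_theta hsw
  rw [Metric.tendsto_nhds]
  intro δ hδ
  -- Error budget: 2ε for discretizing the output, 4ε for the kernel and 3ε for the initial heights
  -- give 9ε below. Above, moving the minimizer γ to the grid costs ε for `f` and 2ε for the kernel,
  -- for a total of 12ε < δ.
  set ε := δ / 13 with hε
  have hε0 : 0 < ε := by positivity
  have ev1 := eventually_forall_abs_sub_le_of_dense hD (tendsto_const_div_pnat 5)
    (fun n s t => abs_heightFunction_plotPermuton_sub_le (v n) y s t) hf hlim hε0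
  have ev2 : ∀ᶠ n : ℕ+ in atTop, ∀ t : I, |(sw n).theta t - φ t| ≤ ε :=
    eventually_forall_abs_sub_le_of_dense (X := I) (F := fun n t => (sw n).theta t)
      (f := fun t => φ t) dense_univ (e := fun _ => 0) tendsto_const_nhds
      (fun n s t => by
        simpa [Subtype.dist_eq, Real.dist_eq] using (sw n).abs_theta_sub_le s t) hφ (fun d _ => hsw d d.2) hε0
  have ev3 := Metric.tendsto_nhds.1 (hne x x.2) ε hε0
  have ev4 := (tendsto_const_div_pnat 1).eventually_le_const hε0
  filter_upwards [ev1, ev2, ev3, ev4] with n h1 h2 h3 h4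
  have hn : 0 < (n : ℕ) := n.pos
  have hn' : (0 : ℝ) < (n : ℕ) := by exact_mod_cast hn
  have h5 : 2 / ((n : ℕ) : ℝ) ≤ 2 * ε := by
    have : 2 / ((n : ℕ) : ℝ) = 2 * (1 / (n : ℕ)) := by ring
    linarith
  set u := tauWord (contentWord (L n)) (v n) with hu
  set b := ⌊((n : ℕ) : ℝ) * y⌋₊ with hb
  have hi : ⌊((n : ℕ) : ℝ) * x⌋₊ ≤ n := floor_mul_le x
  have hux := abs_heightFunction_sub_le u x y
  have hdx := dist_gridPoint_floor hn x hi
  set i := ⌊((n : ℕ) : ℝ) * x⌋₊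
  obtain ⟨hmin, j₀, hj₀, hj₀e⟩ := isKernelMin_tauWord (hle n) (hL n) (v n) b hi
  have hQ : |((ne n).abscissa i : ℝ) / (n : ℕ) - ψ x| ≤ 2 * ε := by
    rw [← (ne n).theta_div hn hi]
    have e1 := (ne n).abs_theta_sub_le (gridPoint hi) x
    have e2 : |((gridPoint hi : I) : ℝ) - x| ≤ 1 / (n : ℕ) := hdx
    have e3 : |(ne n).theta x - ψ x| < ε := h3
    change |(ne n).theta (gridPoint hi : I) - ψ x| ≤ 2 * ε
    have e4 := abs_sub_le ((ne n).theta (gridPoint hi : I)) ((ne n).theta x) (ψ x)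
    linarith
  have hxi : |(i : ℝ) / (n : ℕ) - x| ≤ ε := (show _ ≤ _ from hdx).trans h4
  have hker : ∀ (j : ℕ) (hj : j ≤ (n : ℕ)), |(discreteKernel n (sw n).abscissa ((ne n).abscissa i) i j : ℝ) /
      (n : ℕ) - hFun 1 φ ψ x (gridPoint hj)| ≤ 4 * ε := by
    intro j hj
    have e1 := h2 (gridPoint hj)
    have e2 : ((gridPoint hj : I) : ℝ) = (j : ℝ) / (n : ℕ) := rfl
    rw [discreteKernel_div hn, hFun_one]
    rw [e2, (sw n).theta_div hn hj] at e1
    rw [e2]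
    rw [abs_le] at e1 hxi hQ
    apply abs_min_max_sub_le (by linarith) <;> rw [abs_le] <;> constructor <;>
      linarith [e1.1, e1.2, hxi.1, hxi.2, hQ.1, hQ.2]
  have hv : ∀ (j : ℕ) (hj : j ≤ (n : ℕ)), |(discreteHeight (v n) b j : ℝ) / (n : ℕ) - f (gridPoint hj)| ≤
      3 * ε := by
    intro j hj
    have e1 := h1 (gridPoint hj)
    have e2 := abs_heightFunction_sub_le (v n) (gridPoint hj) y
    rw [floor_mul_gridPoint hn hj] at e2
    rw [abs_le] at *
    constructor <;> linarith [e1.1, e1.2, e2.1, e2.2]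
  rw [abs_le] at hux
  have lower : m - 9 * ε ≤ heightFunction (plotPermuton u) x y := by
    have e1 := hm.2 ⟨gridPoint hj₀, rfl⟩
    have e2 := hker j₀ hj₀
    have e3 := hv j₀ hj₀
    have e4 : (discreteHeight u b i : ℝ) = (discreteHeight (v n) b j₀ : ℝ) +
        (discreteKernel n (sw n).abscissa ((ne n).abscissa i) i j₀ : ℝ) := by
      exact_mod_cast hj₀e
    rw [e4, add_div] at hux
    rw [abs_le] at e2 e3
    simp only at e1
    linarith [e2.1, e2.2, e3.1, e3.2, hux.1]
  have upper : heightFunction (plotPermuton u) x y ≤ m + 12 * ε := by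
    obtain ⟨γ, hγ⟩ := hm.1
    simp only at hγ
    have hj : ⌊((n : ℕ) : ℝ) * γ⌋₊ ≤ n := floor_mul_le γ
    have hd := (dist_gridPoint_floor hn γ hj).trans h4
    have e2 := hker _ hj
    have e3 := hv _ hj
    have e5 := hf (gridPoint hj) γ
    have e6 := abs_hFun_one_sub_le (ψ := ψ) hφ x (gridPoint hj) γ
    have e4 : (discreteHeight u b i : ℝ) ≤ (discreteHeight (v n) b ⌊((n : ℕ) : ℝ) * γ⌋₊ : ℝ) +
        (discreteKernel n (sw n).abscissa ((ne n).abscissa i) i ⌊((n : ℕ) : ℝ) * γ⌋₊ : ℝ) := by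
      exact_mod_cast hmin _ hj
    have e7 := div_le_div_of_nonneg_right e4 hn'.le
    rw [add_div] at e7
    rw [abs_le] at e2 e3 e5 e6
    linarith [e2.1, e2.2, e3.1, e3.2, e5.2, e6.2, hux.2]
  rw [Real.dist_eq]
  apply lt_of_le_of_lt (b := 12 * ε)
  · rw [abs_le]
    constructor <;> linarith
  · linarith

theorem exists_isLeast_add_hFun {φ ψ : ℝ → ℝ} (hφ : ∀ s t : I, |φ s - φ t| ≤ dist s t)
    {f : I → ℝ} (hf : ∀ s t, |f s - f t| ≤ dist s t) (x : I) :
    ∃ m, IsLeast (Set.range fun γ : I => f γ + hFun 1 φ ψ x γ) m := by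
  have hc : Continuous fun γ : I => f γ + hFun 1 φ ψ x γ := by
    have hl : LipschitzWith 3 fun γ : I => f γ + hFun 1 φ ψ x γ := by
      apply LipschitzWith.of_dist_le_mul
      intro s t
      have h1 := hf s t
      have h2 := abs_hFun_one_sub_le (ψ := ψ) hφ x s t
      rw [Real.dist_eq]
      rw [abs_le] at *
      push_cast
      constructor <;> linarith [h1.1, h1.2, h2.1, h2.2]
    exact hl.continuous
  exact (isCompact_range hc).exists_isLeast (Set.range_nonempty _)

/-! ### Concentration for uniform random permutations -/

section Counting

variable {α : Type*} [Fintype α] [DecidableEq α]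

/-- The permutations that map all elements of `S` into `B`. -/
def permsMapsTo (S B : Finset α) : Finset (Equiv.Perm α) :=
  Finset.univ.filter fun u => ∀ k ∈ S, u k ∈ B

theorem mem_permsMapsTo {S B : Finset α} {u : Equiv.Perm α} :
    u ∈ permsMapsTo S B ↔ ∀ k ∈ S, u k ∈ B := by
  simp [permsMapsTo]

theorem card_permsMapsTo_insert {S B : Finset α} {k l : α} (hk : k ∉ S) (hl : l ∉ S) :
    (permsMapsTo (insert k S) B).card = (permsMapsTo (insert l S) B).card := by
  have aux : ∀ (a b : α), a ∉ S → b ∉ S → ∀ u ∈ permsMapsTo (insert a S) B,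
      u * Equiv.swap a b ∈ permsMapsTo (insert b S) B := by
    intro a b ha hb u hu
    rw [mem_permsMapsTo] at hu ⊢
    intro c hc
    rw [Equiv.Perm.mul_apply]
    rcases Finset.mem_insert.1 hc with rfl | hc
    · rw [Equiv.swap_apply_right]
      exact hu _ (Finset.mem_insert_self _ _)
    · rw [Equiv.swap_apply_of_ne_of_ne (ne_of_mem_of_not_mem hc ha) (ne_of_mem_of_not_mem hc hb)]
      exact hu _ (Finset.mem_insert_of_mem hc)
  refine Finset.card_bij' (fun u _ => u * Equiv.swap k l) (fun u _ => u * Equiv.swap l k)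
    (aux k l hk hl) (aux l k hl hk) ?_ ?_
  · intro u _
    rw [Equiv.swap_comm l k, mul_assoc, Equiv.swap_mul_self, mul_one]
  · intro u _
    rw [Equiv.swap_comm l k, mul_assoc, Equiv.swap_mul_self, mul_one]

/-- Double counting of pairs (l, u) with l outside `S` and u mapping `insert l S` into `B`: by
symmetry every l contributes equally, and each u mapping `S` into `B` has exactly |B| - |S| further
points landing in `B`. The additive form avoids truncated subtraction when |B| < |S|. -/
theorem card_permsMapsTo_insert_mul {S B : Finset α} {k : α} (hk : k ∉ S) :
    (Fintype.card α - S.card) * (permsMapsTo (insert k S) B).card +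
      S.card * (permsMapsTo S B).card = B.card * (permsMapsTo S B).card := by
  have h1 : (Fintype.card α - S.card) * (permsMapsTo (insert k S) B).card =
      ∑ l ∈ Sᶜ, (permsMapsTo (insert l S) B).card := by
    rw [← Finset.card_compl, ← smul_eq_mul, ← Finset.sum_const]
    exact Finset.sum_congr rfl fun l hl =>
      card_permsMapsTo_insert hk (Finset.mem_compl.1 hl)
  have h2 : ∑ l ∈ Sᶜ, (permsMapsTo (insert l S) B).card =
      ∑ u ∈ permsMapsTo S B, (Sᶜ.filter fun l => u l ∈ B).card := by
    refine Eq.trans ?_ (Finset.sum_card_bipartiteAbove_eq_sum_card_bipartiteBelow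
      (s := Sᶜ) (t := permsMapsTo S B) (r := fun (l : α) (u : Equiv.Perm α) => u l ∈ B))
    refine Finset.sum_congr rfl fun l _ => ?_
    congr 1
    ext u
    simp only [Finset.mem_bipartiteAbove, mem_permsMapsTo, Finset.forall_mem_insert]
    tauto
  have h3 : ∀ u ∈ permsMapsTo S B, (Sᶜ.filter fun l => u l ∈ B).card + S.card = B.card := by
    intro u hu
    have hd : Disjoint (Sᶜ.filter fun l => u l ∈ B) S := by
      rw [Finset.disjoint_left]
      intro l hl
      exact Finset.mem_compl.1 (Finset.mem_filter.1 hl).1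
    rw [← Finset.card_union_of_disjoint hd]
    apply Finset.card_bij (fun l _ => u l)
    · intro l hl
      rcases Finset.mem_union.1 hl with h | h
      · exact (Finset.mem_filter.1 h).2
      · exact mem_permsMapsTo.1 hu l h
    · intro a _ b _ hab
      exact u.injective hab
    · intro c hc
      refine ⟨u.symm c, ?_, u.apply_symm_apply c⟩
      rw [Finset.mem_union, Finset.mem_filter, Finset.mem_compl, u.apply_symm_apply]
      tauto
  rw [h1, h2, mul_comm S.card, mul_comm B.card, ← smul_eq_mul (permsMapsTo S B).card S.card,
    ← Finset.sum_const, ← Finset.sum_add_distrib, Finset.sum_congr rfl h3, Finset.sum_const,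
    smul_eq_mul]

/-- Negative correlation of the events `u k ∈ B` for a uniform random permutation `u`. -/
theorem card_permsMapsTo_le (S B : Finset α) :
    (permsMapsTo S B).card * Fintype.card α ^ S.card ≤
      B.card ^ S.card * (Fintype.card α).factorial := by
  induction S using Finset.induction_on with
  | empty =>
    simpa [Fintype.card_perm] using Finset.card_le_univ (permsMapsTo (∅ : Finset α) B)
  | insert k S hk ih =>
    have hS : S.card < Fintype.card α := Finset.card_lt_univ_of_notMem hk
    have hB : B.card ≤ Fintype.card α := Finset.card_le_univ B
    have h1 := card_permsMapsTo_insert_mul (B := B) hk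
    -- This is (|B| - |S|)/(n - |S|) ≤ |B|/n, valid since |B| ≤ n: sampling without replacement is
    -- dominated by sampling with replacement.
    have h2 : Fintype.card α * (permsMapsTo (insert k S) B).card ≤
        B.card * (permsMapsTo S B).card := by
      obtain ⟨d, hd⟩ : ∃ d, Fintype.card α = S.card + d := ⟨_, (Nat.add_sub_cancel' hS.le).symm⟩
      have hd0 : 0 < d := by omega
      rw [hd, Nat.add_sub_cancel_left] at h1
      have h3 := Nat.mul_le_mul_right (S.card * (permsMapsTo S B).card) hB
      rw [hd] at h3 ⊢
      apply Nat.le_of_mul_le_mul_left _ hd0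
      nlinarith [h1, h3]
    rw [Finset.card_insert_of_notMem hk, pow_succ, pow_succ]
    calc _ = Fintype.card α * (permsMapsTo (insert k S) B).card * Fintype.card α ^ S.card := by
          ring
      _ ≤ B.card * (permsMapsTo S B).card * Fintype.card α ^ S.card :=
          Nat.mul_le_mul_right _ h2
      _ = B.card * ((permsMapsTo S B).card * Fintype.card α ^ S.card) := by ring
      _ ≤ B.card * (B.card ^ S.card * (Fintype.card α).factorial) := Nat.mul_le_mul_left _ ih
      _ = _ := by ring

/-- Expanding (1 + t)^X over subsets of `A` has nonnegative coefficients when t ≥ 0, so negative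
correlation bounds the generating function by that of a binomial variable with success probability
|B|/n. -/
theorem sum_perm_pow_card_le [Nonempty α] (A B : Finset α) {t : ℝ} (ht : 0 ≤ t) :
    ∑ u : Equiv.Perm α, (1 + t) ^ (A.filter fun k => u k ∈ B).card ≤
      (Fintype.card α).factorial * (1 + t * (B.card / Fintype.card α)) ^ A.card := by
  have hn : (0 : ℝ) < Fintype.card α := by exact_mod_cast Fintype.card_pos
  have h1 : ∀ u : Equiv.Perm α, (1 + t) ^ (A.filter fun k => u k ∈ B).card =
      ∑ S ∈ A.powerset, if u ∈ permsMapsTo S B then t ^ S.card else 0 := by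
    intro u
    have : (1 + t) ^ (A.filter fun k => u k ∈ B).card =
        ∏ k ∈ A, (1 + if u k ∈ B then t else 0) := by
      rw [← Finset.prod_const, Finset.prod_filter]
      refine Finset.prod_congr rfl fun k _ => ?_
      split_ifs <;> simp
    rw [this, Finset.prod_one_add]
    refine Finset.sum_congr rfl fun S _ => ?_
    split_ifs with h
    · rw [← Finset.prod_const]
      exact Finset.prod_congr rfl fun k hk => if_pos (mem_permsMapsTo.1 h k hk)
    · rw [mem_permsMapsTo] at h
      push Not at h
      obtain ⟨k, hk, hkB⟩ := h
      exact Finset.prod_eq_zero hk (if_neg hkB)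
  simp only [h1]
  rw [Finset.sum_comm]
  calc _ = ∑ S ∈ A.powerset, ((permsMapsTo S B).card : ℝ) * t ^ S.card := by
        refine Finset.sum_congr rfl fun S _ => ?_
        rw [← Finset.sum_filter, Finset.sum_const, nsmul_eq_mul]
        simp
    _ ≤ ∑ S ∈ A.powerset, ((Fintype.card α).factorial : ℝ) *
          (t * (B.card / Fintype.card α)) ^ S.card := by
        refine Finset.sum_le_sum fun S _ => ?_
        have h2 : ((permsMapsTo S B).card : ℝ) * (Fintype.card α : ℝ) ^ S.card ≤
            (B.card : ℝ) ^ S.card * ((Fintype.card α).factorial : ℝ) := by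
          exact_mod_cast card_permsMapsTo_le S B
        have h3 : ((permsMapsTo S B).card : ℝ) ≤
            (B.card : ℝ) ^ S.card * ((Fintype.card α).factorial : ℝ) /
              (Fintype.card α : ℝ) ^ S.card := by
          rwa [le_div_iff₀ (by positivity)]
        calc _ ≤ (B.card : ℝ) ^ S.card * ((Fintype.card α).factorial : ℝ) /
              (Fintype.card α : ℝ) ^ S.card * t ^ S.card := by gcongr
          _ = _ := by
            rw [mul_pow, div_pow]
            ring
    _ = _ := by
        rw [← Finset.mul_sum, ← Finset.prod_const, Finset.prod_one_add]
        simp only [Finset.prod_const]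

theorem card_upper_tail_le [Nonempty α] (A B : Finset α) {ε : ℝ} (hε : 0 ≤ ε) (hε1 : ε ≤ 1) :
    ((Finset.univ.filter fun u : Equiv.Perm α => A.card * (B.card / Fintype.card α : ℝ) +
      ε * Fintype.card α ≤ (A.filter fun k => u k ∈ B).card).card : ℝ) ≤
      (Fintype.card α).factorial * Real.exp (Fintype.card α * -(ε ^ 2 / 4)) := by
  have hn : (0 : ℝ) < Fintype.card α := by exact_mod_cast Fintype.card_pos
  set n : ℝ := (Fintype.card α : ℝ)
  set p : ℝ := (B.card : ℝ) / n with hp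
  set m : ℝ := (A.card : ℝ)
  have hp0 : 0 ≤ p := by positivity
  have hp1 : p ≤ 1 := by
    rw [hp, div_le_one hn]
    exact Nat.cast_le.2 (Finset.card_le_univ B)
  have hm1 : m ≤ n := Nat.cast_le.2 (Finset.card_le_univ A)
  have hm0 : 0 ≤ m := by positivity
  set T := Finset.univ.filter fun u : Equiv.Perm α =>
    m * p + ε * n ≤ (A.filter fun k => u k ∈ B).card with hT
  -- Chernoff parameter: with e^a - 1 ≤ a + a² the exponent is at most n(a² - aε), minimized at a =
  -- ε/2 with value -nε²/4.
  set a : ℝ := ε / 2 with ha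
  have ha0 : 0 ≤ a := by positivity
  have ht : 0 ≤ Real.exp a - 1 := by linarith [Real.one_le_exp ha0]
  have hexp : Real.exp a - 1 ≤ a + a ^ 2 := by
    have := Real.abs_exp_sub_one_sub_id_le (x := a) (by rw [abs_of_nonneg ha0]; linarith)
    linarith [(abs_le.1 this).2]
  have h1 : (T.card : ℝ) * Real.exp (a * (m * p + ε * n)) ≤
      (Fintype.card α).factorial * Real.exp ((Real.exp a - 1) * p * m) := by
    calc _ = ∑ u ∈ T, Real.exp (a * (m * p + ε * n)) := by
          rw [Finset.sum_const, nsmul_eq_mul]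
      _ ≤ ∑ u ∈ T, (1 + (Real.exp a - 1)) ^ (A.filter fun k => u k ∈ B).card := by
          refine Finset.sum_le_sum fun u hu => ?_
          rw [add_sub_cancel, ← Real.exp_nat_mul, mul_comm a]
          exact Real.exp_le_exp.2 (mul_le_mul_of_nonneg_right (Finset.mem_filter.1 hu).2 ha0)
      _ ≤ ∑ u : Equiv.Perm α, (1 + (Real.exp a - 1)) ^ (A.filter fun k => u k ∈ B).card :=
          Finset.sum_le_univ_sum_of_nonneg fun u => by positivity
      _ ≤ _ := sum_perm_pow_card_le A B ht
      _ ≤ (Fintype.card α).factorial * Real.exp ((Real.exp a - 1) * p) ^ A.card := by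
          gcongr
          rw [add_comm]
          exact Real.add_one_le_exp _
      _ = _ := by
          rw [← Real.exp_nat_mul, mul_comm (A.card : ℝ)]
  have h2 : (T.card : ℝ) ≤ (Fintype.card α).factorial *
      Real.exp ((Real.exp a - 1) * p * m - a * (m * p + ε * n)) := by
    rw [Real.exp_sub, ← mul_div_assoc, le_div_iff₀ (Real.exp_pos _)]
    exact h1
  refine h2.trans ?_
  gcongr
  have h3 : (Real.exp a - 1) * (p * m) ≤ (a + a ^ 2) * (p * m) := by gcongr
  have h4 : p * m ≤ n := by nlinarith
  have h5 : a ^ 2 * (p * m) ≤ a ^ 2 * n := by gcongr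
  have h6 : n * -(ε ^ 2 / 4) = a ^ 2 * n - a * (ε * n) := by
    rw [ha]
    ring
  rw [h6]
  nlinarith

theorem card_two_sided_tail_le [Nonempty α] (A B : Finset α) {ε : ℝ} (hε : 0 ≤ ε)
    (hε1 : ε ≤ 1) :
    ((Finset.univ.filter fun u : Equiv.Perm α => ε * Fintype.card α ≤
      |((A.filter fun k => u k ∈ B).card : ℝ) -
        A.card * (B.card / Fintype.card α : ℝ)|).card : ℝ) ≤
      (Fintype.card α).factorial * (2 * Real.exp (Fintype.card α * -(ε ^ 2 / 4))) := by
  have hn : (0 : ℝ) < Fintype.card α := by exact_mod_cast Fintype.card_pos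
  have h1 := card_upper_tail_le A B hε hε1
  have h2 := card_upper_tail_le A Bᶜ hε hε1
  set U := Finset.univ.filter fun u : Equiv.Perm α => A.card * (B.card / Fintype.card α : ℝ) +
      ε * Fintype.card α ≤ (A.filter fun k => u k ∈ B).card with hU
  set U' := Finset.univ.filter fun u : Equiv.Perm α => A.card * (Bᶜ.card / Fintype.card α : ℝ) +
      ε * Fintype.card α ≤ (A.filter fun k => u k ∈ Bᶜ).card with hU'
  have hsub : (Finset.univ.filter fun u : Equiv.Perm α => ε * Fintype.card α ≤
      |((A.filter fun k => u k ∈ B).card : ℝ) - A.card * (B.card / Fintype.card α : ℝ)|) ⊆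
      U ∪ U' := by
    intro u hu
    rw [Finset.mem_filter] at hu
    rw [Finset.mem_union, hU, hU', Finset.mem_filter, Finset.mem_filter]
    -- A deficit of values in `B` is an excess of values in the complement, so the upper tail bound
    -- covers both sides.
    rcases le_abs'.1 hu.2 with h | h
    · right
      refine ⟨Finset.mem_univ _, ?_⟩
      have e1 : ((A.filter fun k => u k ∈ B).card : ℝ) +
          (A.filter fun k => u k ∈ Bᶜ).card = A.card := by
        simp only [Finset.mem_compl]
        exact_mod_cast Finset.card_filter_add_card_filter_not (s := A) (fun k => u k ∈ B)
      have e2 : (Bᶜ.card : ℝ) = Fintype.card α - B.card := by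
        rw [Finset.card_compl, Nat.cast_sub (Finset.card_le_univ B)]
      rw [e2, sub_div, div_self hn.ne', mul_sub, mul_one]
      linarith
    · left
      refine ⟨Finset.mem_univ _, ?_⟩
      linarith
  have h3 : ((Finset.univ.filter fun u : Equiv.Perm α => ε * Fintype.card α ≤
      |((A.filter fun k => u k ∈ B).card : ℝ) -
        A.card * (B.card / Fintype.card α : ℝ)|).card : ℝ) ≤ U.card + U'.card := by
    exact_mod_cast (Finset.card_le_card hsub).trans (Finset.card_union_le _ _)
  linarith

end Counting

theorem card_filter_abs_discreteHeight_le {n : ℕ} (hn : 0 < n) {i b : ℕ} (hi : i ≤ n)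
    (hb : b ≤ n) {ε : ℝ} (hε : 0 ≤ ε) (hε1 : ε ≤ 1) :
    ((Finset.univ.filter fun u : Equiv.Perm (Fin n) =>
      ε * n ≤ |(discreteHeight u b i : ℝ) - (n - i) * (b / n)|).card : ℝ) ≤
      n.factorial * (2 * Real.exp (n * -(ε ^ 2 / 4))) := by
  have : Nonempty (Fin n) := ⟨⟨0, hn⟩⟩
  have key := card_two_sided_tail_le (Finset.univ.filter fun k : Fin n => i ≤ (k : ℕ))
    (Finset.univ.filter fun k : Fin n => (k : ℕ) < b) hε hε1
  have hB : (Finset.univ.filter fun k : Fin n => (k : ℕ) < b).card = b := by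
    rw [Fin.card_filter_val_lt, min_eq_right hb]
  have hA : (Finset.univ.filter fun k : Fin n => i ≤ (k : ℕ)).card = n - i := by
    have h1 := Finset.card_filter_add_card_filter_not (s := (Finset.univ : Finset (Fin n)))
      (fun k : Fin n => (k : ℕ) < i)
    rw [Fin.card_filter_val_lt, min_eq_right hi, Finset.card_univ, Fintype.card_fin] at h1
    simp only [not_lt] at h1
    omega
  rw [hA, hB, Fintype.card_fin, Nat.cast_sub hi] at key
  convert key using 6 with u
  rw [discreteHeight, Finset.filter_filter]
  simp

/-- Almost sure pointwise convergence of the height functions of uniform random permutations. -/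
theorem ae_tendsto_heightFunction_uniform {Ω : Type*} [MeasurableSpace Ω] (P : Measure Ω)
    {v : ∀ n : ℕ+, Ω → Equiv.Perm (Fin n)}
    (hv : ∀ (n : ℕ+) (w : Equiv.Perm (Fin n)),
      P {ω | v n ω = w} = (((n : ℕ).factorial : ℕ) : ENNReal)⁻¹) (x y : I) :
    ∀ᵐ ω ∂P, Tendsto (fun n => heightFunction (plotPermuton (v n ω)) x y) atTop
      (𝓝 ((1 - (x : ℝ)) * y)) := by
  set T : ℝ → ∀ n : ℕ+, Finset (Equiv.Perm (Fin n)) := fun ε n =>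
    Finset.univ.filter fun u => ε * (n : ℕ) ≤
      |(discreteHeight u ⌊((n : ℕ) : ℝ) * y⌋₊ ⌊((n : ℕ) : ℝ) * x⌋₊ : ℝ) -
        ((n : ℕ) - (⌊((n : ℕ) : ℝ) * x⌋₊ : ℝ)) * ((⌊((n : ℕ) : ℝ) * y⌋₊ : ℝ) / (n : ℕ))| with hT
  -- First Borel–Cantelli lemma: for each tolerance 1/(k + 1) the exponential tail bounds are
  -- summable, so almost surely only finitely many `n` deviate. Countably many tolerances suffice.
  have bc : ∀ k : ℕ, ∀ᵐ ω ∂P, {n : ℕ+ | v n ω ∈ T (1 / ((k : ℝ) + 1)) n}.Finite := by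
    intro k
    set ε : ℝ := 1 / ((k : ℝ) + 1) with hε
    have hε0 : 0 < ε := by positivity
    have hε1 : ε ≤ 1 := by
      rw [hε, div_le_one (by positivity)]
      linarith [k.cast_nonneg (α := ℝ)]
    have hbound : ∀ n : ℕ+, P {ω | v n ω ∈ T ε n} ≤
        ENNReal.ofReal (2 * Real.exp ((n : ℕ) * -(ε ^ 2 / 4))) := by
      intro n
      have e1 : {ω | v n ω ∈ T ε n} = ⋃ w ∈ T ε n, {ω | v n ω = w} := by
        ext ω
        simp
      have e2 := card_filter_abs_discreteHeight_le n.pos (floor_mul_le (n := n) x)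
        (floor_mul_le (n := n) y) hε0.le hε1
      have hf : (0 : ℝ) < ((n : ℕ).factorial : ℝ) := by exact_mod_cast Nat.factorial_pos _
      calc P {ω | v n ω ∈ T ε n} ≤ ∑ w ∈ T ε n, P {ω | v n ω = w} := by
            rw [e1]
            exact measure_biUnion_finset_le _ _
        _ = ((T ε n).card : ENNReal) * (((n : ℕ).factorial : ℕ) : ENNReal)⁻¹ := by
            simp only [hv, Finset.sum_const, nsmul_eq_mul]
        _ = ENNReal.ofReal ((T ε n).card / (n : ℕ).factorial) := by
            rw [ENNReal.ofReal_div_of_pos hf, ENNReal.ofReal_natCast, ENNReal.ofReal_natCast,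
              div_eq_mul_inv]
        _ ≤ _ := by
            apply ENNReal.ofReal_le_ofReal
            rw [div_le_iff₀ hf, mul_comm]
            exact e2
    have hsum : Summable fun n : ℕ+ => 2 * Real.exp (((n : ℕ) : ℝ) * -(ε ^ 2 / 4)) :=
      ((Real.summable_exp_nat_mul_iff.2 (by
        have : 0 < ε ^ 2 := by positivity
        linarith : -(ε ^ 2 / 4) < 0)).mul_left 2).comp_injective PNat.coe_injective
    exact ae_finite_setOfPred_mem
      (ne_top_of_le_ne_top hsum.tsum_ofReal_ne_top (ENNReal.tsum_le_tsum hbound))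
  filter_upwards [ae_all_iff.2 bc] with ω hω
  rw [Metric.tendsto_nhds]
  intro δ hδ
  obtain ⟨k, hk⟩ := exists_nat_one_div_lt (show 0 < δ / 2 by positivity)
  obtain ⟨N, hN⟩ := (hω k).bddAbove
  filter_upwards [eventually_gt_atTop N,
    (tendsto_const_div_pnat 4).eventually_le_const (show 0 < δ / 2 by positivity)] with n h1 h2
  have hn' : (0 : ℝ) < (n : ℕ) := by exact_mod_cast n.pos
  have h3 : v n ω ∉ T (1 / ((k : ℝ) + 1)) n := fun h => absurd (hN h) (not_le.2 h1)
  simp only [hT, Finset.mem_filter, Finset.mem_univ, true_and, not_le] at h3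
  have h4 := abs_heightFunction_sub_le (v n ω) x y
  have hx := dist_gridPoint_floor n.pos x (floor_mul_le x)
  have hy := dist_gridPoint_floor n.pos y (floor_mul_le y)
  rw [Subtype.dist_eq, Real.dist_eq] at hx hy
  change |(⌊((n : ℕ) : ℝ) * x⌋₊ : ℝ) / (n : ℕ) - x| ≤ _ at hx
  change |(⌊((n : ℕ) : ℝ) * y⌋₊ : ℝ) / (n : ℕ) - y| ≤ _ at hy
  have hyn : (⌊((n : ℕ) : ℝ) * y⌋₊ : ℝ) / (n : ℕ) ≤ 1 :=
    (gridPoint (floor_mul_le (n := n) y)).2.2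
  set i : ℝ := (⌊((n : ℕ) : ℝ) * x⌋₊ : ℝ)
  set b : ℝ := (⌊((n : ℕ) : ℝ) * y⌋₊ : ℝ)
  set h : ℝ := (discreteHeight (v n ω) ⌊((n : ℕ) : ℝ) * y⌋₊ ⌊((n : ℕ) : ℝ) * x⌋₊ : ℝ)
  have hb0 : 0 ≤ b / (n : ℕ) := by positivity
  have h5 : |h / (n : ℕ) - (1 - i / (n : ℕ)) * (b / (n : ℕ))| ≤ 1 / ((k : ℝ) + 1) := by
    have : h / (n : ℕ) - (1 - i / (n : ℕ)) * (b / (n : ℕ)) =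
        (h - ((n : ℕ) - i) * (b / (n : ℕ))) / (n : ℕ) := by field_simp
    rw [this, abs_div, abs_of_pos hn', div_le_iff₀ hn']
    exact h3.le
  have h6 : |(1 - i / (n : ℕ)) * (b / (n : ℕ)) - (1 - (x : ℝ)) * y| ≤ 2 / (n : ℕ) := by
    have e : (1 - i / (n : ℕ)) * (b / (n : ℕ)) - (1 - (x : ℝ)) * y =
        -((i / (n : ℕ) - x) * (b / (n : ℕ))) + (1 - (x : ℝ)) * (b / (n : ℕ) - y) := by ring
    rw [e]
    refine (abs_add_le _ _).trans ?_
    rw [abs_neg, abs_mul, abs_mul, abs_of_nonneg hb0,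
      abs_of_nonneg (sub_nonneg.2 x.2.2)]
    have e1 := mul_le_of_le_one_right (abs_nonneg (i / (n : ℕ) - x)) hyn
    have e2 := mul_le_of_le_one_left (abs_nonneg (b / (n : ℕ) - y))
      (show 1 - (x : ℝ) ≤ 1 by linarith [x.2.1])
    have e3 : (2 : ℝ) / (n : ℕ) = 1 / (n : ℕ) + 1 / (n : ℕ) := by ring
    linarith
  rw [Real.dist_eq]
  have e4 : (4 : ℝ) / (n : ℕ) = 2 / (n : ℕ) + 2 / (n : ℕ) := by ring
  rw [abs_le] at h4 h5 h6
  rw [abs_lt]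
  constructor <;> linarith [h4.1, h4.2, h5.1, h5.2, h6.1, h6.2]

/-! ### Height functions under weak convergence -/

/-- The boundary of the rectangle relative to the unit square lies in one horizontal and one
vertical line, which a permuton does not charge; the portmanteau theorem applies. -/
theorem tendsto_heightFunction_of_tendsto {v : ∀ n : ℕ+, Equiv.Perm (Fin n)}
    {μ : ProbabilityMeasure (I × I)} (hμ : IsPermuton μ)
    (h : Tendsto (fun n => plotPermuton (v n)) atTop (𝓝 μ)) (x y : I) :
    Tendsto (fun n => heightFunction (plotPermuton (v n)) x y) atTop
      (𝓝 (heightFunction μ x y)) := by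
  have hnull : (μ : Measure (I × I)) (frontier (Set.Icc x 1 ×ˢ Set.Icc 0 y)) = 0 := by
    have hx : frontier (Set.Icc x 1) ⊆ Set.Icc x x := by
      have : Set.Icc x 1 = Set.Ici x := by
        ext t
        simp [unitInterval.le_one']
      rw [this, Set.Icc_self]
      exact frontier_Ici_subset x
    have hy : frontier (Set.Icc 0 y) ⊆ Set.Icc y y := by
      have : Set.Icc 0 y = Set.Iic y := by
        ext t
        simp
      rw [this, Set.Icc_self]
      exact frontier_Iic_subset y
    refine measure_mono_null (t := Set.univ ×ˢ Set.Icc y y ∪ Set.Icc x x ×ˢ Set.univ) ?_ ?_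
    · rw [frontier_prod_eq]
      exact Set.union_subset_union (Set.prod_mono (Set.subset_univ _) hy)
        (Set.prod_mono hx (Set.subset_univ _))
    · rw [measure_union_null_iff, (hμ y y le_rfl).1, (hμ x x le_rfl).2]
      simp
  exact (ENNReal.tendsto_toReal (measure_ne_top _ _)).comp
    (ProbabilityMeasure.tendsto_measure_of_null_frontier_of_tendsto' h hnull)

theorem abs_heightFunction_sub_le_of_tendsto {v : ∀ n : ℕ+, Equiv.Perm (Fin n)}
    {μ : ProbabilityMeasure (I × I)} (hμ : IsPermuton μ)
    (h : Tendsto (fun n => plotPermuton (v n)) atTop (𝓝 μ)) (y s t : I) :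
    |heightFunction μ s y - heightFunction μ t y| ≤ dist s t := by
  have h1 := ((tendsto_heightFunction_of_tendsto hμ h s y).sub
    (tendsto_heightFunction_of_tendsto hμ h t y)).abs
  have h2 : Tendsto (fun n : ℕ+ => dist s t + 5 / ((n : ℕ) : ℝ)) atTop (𝓝 (dist s t)) := by
    simpa using (tendsto_const_div_pnat 5).const_add (dist s t)
  exact le_of_tendsto_of_tendsto' h1 h2 fun n =>
    abs_heightFunction_plotPermuton_sub_le (v n) y s t

/-! ### The limit theorem for convergent and for uniform random initial permutations -/

theorem theorem1p3
    (φ ψ : ℝ → ℝ) (hφ : IsBoundary φ) (hψ : IsBoundary ψ)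
    (hφψ : ∀ z ∈ Set.Icc (0 : ℝ) 1, φ z ≤ ψ z)
    (sw ne : ∀ n : ℕ+, LatticePath n)
    (hle : ∀ n, (sw n).WeaklySW (ne n))
    (hsw : ∀ z ∈ Set.Icc (0 : ℝ) 1, Tendsto (fun n => (sw n).theta z) atTop (𝓝 (φ z)))
    (hne : ∀ z ∈ Set.Icc (0 : ℝ) 1, Tendsto (fun n => (ne n).theta z) atTop (𝓝 (ψ z)))
    (L : ℕ+ → List (ℤ × ℤ))
    (hL : ∀ n, IsLinearExtension (orderConvexShape (sw n) (ne n)) (L n)) :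
    (∀ (v : ∀ n : ℕ+, Equiv.Perm (Fin n)) (μ : ProbabilityMeasure (I × I)),
      IsPermuton μ →
      Tendsto (fun n => plotPermuton (v n)) atTop (𝓝 μ) →
      ∀ x y : I, ∃ m : ℝ,
        IsLeast (Set.range fun γ : I => heightFunction μ γ y + hFun 1 φ ψ x γ) m ∧
        Tendsto (fun n => heightFunction (plotPermuton (tauWord (contentWord (L n)) (v n))) x y)
          atTop (𝓝 m)) ∧
    (∀ (Ω : Type*) [MeasurableSpace Ω] (P : Measure Ω) [IsProbabilityMeasure P]
      (v : ∀ n : ℕ+, Ω → Equiv.Perm (Fin n)),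
      (∀ n, Measurable (v n)) →
      iIndepFun v P →
      (∀ (n : ℕ+) (w : Equiv.Perm (Fin n)),
        P {ω | v n ω = w} = (((n : ℕ).factorial : ℕ) : ENNReal)⁻¹) →
      ∀ x y : I, ∃ m : ℝ,
        IsLeast (Set.range fun γ : I => (1 - (γ : ℝ)) * y + hFun 1 φ ψ x γ) m ∧
        ∀ᵐ ω ∂P, Tendsto
          (fun n => heightFunction (plotPermuton (tauWord (contentWord (L n)) (v n ω))) x y)
          atTop (𝓝 m)) := by
  have hφl := abs_sub_le_of_tendsto_theta hsw
  constructor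
  · intro v μ hμ hv x y
    have hf := abs_heightFunction_sub_le_of_tendsto hμ hv y
    obtain ⟨m, hm⟩ := exists_isLeast_add_hFun (ψ := ψ) hφl hf x
    exact ⟨m, hm, tendsto_heightFunction_tauWord hle hsw hne hL v x y hf dense_univ
      (fun d _ => tendsto_heightFunction_of_tendsto hμ hv d y) hm⟩
  · intro Ω _ P _ v _ _ hv x y
    have hf : ∀ s t : I, |(1 - (s : ℝ)) * y - (1 - (t : ℝ)) * y| ≤ dist s t := by
      intro s t
      rw [← sub_mul, sub_sub_sub_cancel_left, abs_mul, abs_of_nonneg y.2.1, abs_sub_comm]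
      exact mul_le_of_le_one_right (abs_nonneg _) y.2.2
    obtain ⟨m, hm⟩ := exists_isLeast_add_hFun (ψ := ψ) hφl hf x
    -- The exceptional null set depends on the point, so convergence is first secured simultaneously
    -- on a countable dense set; the deterministic limit then applies to each remaining `ω`.
    obtain ⟨D, hDc, hD⟩ := TopologicalSpace.exists_countable_dense I
    refine ⟨m, hm, ?_⟩
    have hae := (ae_ball_iff hDc).2 fun d (_ : d ∈ D) => ae_tendsto_heightFunction_uniform P hv d y
    filter_upwards [hae] with ω hω
    exact tendsto_heightFunction_tauWord hle hsw hne hL (fun n => v n ω) x y hf hD hω hm
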